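/- Let $\mathbb T=\mathbb R/\mathbb Z$ with its usual distance and give $\mathbb T^2$ the maximum distance. There is an absolute constant $C>0$ such that the following holds. Let $(\Omega,\mathcal F,\mathbb P,\theta)$ be a probability-preserving transformation, $L\ge 1$, $N=L+1$, $\alpha>0$, $\lambda\in(0,1)$. For each node $i=1,\dots,N$ let $\varphi_i:\mathbb N\times\Omega\times\mathbb T\to\mathbb T$ be measurable with the cocycle property $\varphi_i(0,\omega,\cdot)=\mathrm{id}$, $\varphi_i(t+s,\omega,\cdot)=\varphi_i(t,\theta^s\omega,\cdot)\circ\varphi_i(s,\omega,\cdot)$; assume that the random maps $\varphi_i(1,\theta^t\omega,\cdot)$, $t\in\mathbb N$, $1\le i\le N$, are independent and identically distributed, and that $d(\varphi_i(1,\omega,x),\varphi_i(1,\omega,y))\le\lambda\, d(x,y)$ for all $i,\omega,x,y$. Let $h:\Omega\times\mathbb T^2\to\mathbb R$ be such that $h(\omega,\cdot,\cdot)$ is a random element of $C^4(\mathbb T^2;\mathbb R)$ and the $h(\theta^t\omega,\cdot,\cdot)$, $t\in\mathbb N$, are independent and identically distributed. Let $\Phi_\alpha(t,\omega,x)=x^t=(z^t,x_2^t,\dots,x_N^t)$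 be the star network dynamics with $x^0=x$ and $$z^{t+1}=\varphi_1(1,\theta^t\omega,z^t)+\frac{\alpha}{L}\sum_{j=2}^N h(\theta^t\omega,z^t,x_j^t)\bmod 1,\qquad x_j^{t+1}=\varphi_j(1,\theta^t\omega,x_j^t)+\frac{\alpha}{L}h(\theta^t\omega,x_j^t,z^t)\bmod 1\quad(2\le j\le N).$$ Let $\pi(\omega)=\lim_{n\to\infty}\varphi_1(1,\omega,\cdot)\circ\varphi_1(1,\theta\omega,\cdot)\circ\cdots\circ\varphi_1(1,\theta^{n-1}\omega,p)$, which does not depend on $p\in\mathbb T$, and $m_0=\pi_*\mathbb P$. Then $m_0$ is the unique stationary probability measure of each node chain, i.e. for every $i$ it is the only Borel probability measure $m$ with $\int\mathbb P(\varphi_i(1,\omega,x)\in B)\,dm(x)=m(B)$ for all Borel $B$. Let $\varphi_{\alpha,m_0}$ be the reduced hub system with $\varphi_{\alpha,m_0}(1,\omega,z)=\varphi_1(1,\omega,z)+\alpha\int h(\omega,z,y)\,dm_0(y) \bmod 1$, so that $z^{t+1}=\varphi_{\alpha,m_0}(1,\theta^t\omega,z^t)+\xi(\theta^t\omega,x^t)\bmod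 1$ with the fluctuation $$\xi(\omega,x)=\alpha\Big(\frac1L\sum_{j=2}^N h(\omega,z,x_j)-\int_{\mathbb T} h(\omega,z,y)\,dm_0(y)\Big),\qquad x=(z,x_2,\dots,x_N).$$ The hub is said to admit $\varepsilon$-reduction to $\varphi_{\alpha,m_0}$ on initial data $(\omega,x)$ with exceptional frequency at most $\rho$ if $$\limsup_{T\to\infty}\frac1T\#\{0\le t\le T-1:\ |\xi(\theta^t\omega,\Phi_\alpha(t,\omega,x))|>\varepsilon\}\le\rho .$$ Write $\|g\|_{C^4}=\max_{a+b\le4}\sup|\partial_1^a\partial_2^b g|$. Then for $\mathbb P$-almost every $\omega$ with $\sup_t\|h(\theta^t\omega,\cdot,\cdot)\|_{C^4}<\infty$, for every $$\varepsilon\ge\max\Big\{\alpha L^{-1/2},\ 4\alpha^2L^{-1}(1-\lambda)^{-1}\sup_{t}\|h(\theta^t\omega,\cdot,\cdot)\|_{C^0}\,\sup_{t}|h(\theta^t\omega,\cdot,\cdot)|_{\mathrm{Lip}}\Big\}$$ and every $x\in\mathbb T^N$, the hub admits $\varepsilon$-reduction to $\varphi_{\alpha,m_0}$ on $(\omega,x)$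 with exceptional frequency at most $$\rho(\varepsilon,\omega)=D(\varepsilon,\omega)\exp\big(-L\varepsilon^2\alpha^{-2}c(\omega)\big),\qquad D(\varepsilon,\omega)=C\,\varepsilon^{-1}\sup_t\|h(\theta^t\omega,\cdot,\cdot)\|_{C^4},\quad c(\omega)=\frac{450}{\sup_t\|h(\theta^t\omega,\cdot,\cdot)\|_{C^4}^2}.$$ (If the last supremum is $0$, the exceptional frequency is $0$.) -/

import Mathlib

open MeasureTheory ProbabilityTheory Filter

/-- A measurable random dynamical system `φ : ℕ × Ω × M → M` over `θ : Ω → Ω`: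
measurable in `(ω, x)` at every time, with the cocycle property. -/
structure IsRDS {Ω M : Type*} [MeasurableSpace Ω] [MeasurableSpace M]
    (θ : Ω → Ω) (φ : ℕ → Ω → M → M) : Prop where
  measurable : ∀ t, Measurable (fun p : Ω × M => φ t p.1 p.2)
  zero : ∀ ω x, φ 0 ω x = x
  add : ∀ t s ω x, φ (t + s) ω x = φ t (θ^[s] ω) (φ s ω x)

/-- The node maps `φ i 1 (θ^t ω)` are independent and identically distributed over all times `t` and
nodes `i`. Maps of the circle carry the σ-algebra generated by the evaluations; on the continuous
maps this is the Borel σ-algebra of uniform convergence. -/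
structure IIDNodeMaps {Ω ι : Type*} [MeasurableSpace Ω] (P : Measure Ω) (θ : Ω → Ω)
    (φ : ι → ℕ → Ω → UnitAddCircle → UnitAddCircle) : Prop where
  indep : iIndepFun (fun (p : ℕ × ι) (ω : Ω) (x : UnitAddCircle) => φ p.2 1 (θ^[p.1] ω) x) P
  ident : ∀ p q : ℕ × ι,
    IdentDistrib (fun (ω : Ω) (x : UnitAddCircle) => φ p.2 1 (θ^[p.1] ω) x)
      (fun (ω : Ω) (x : UnitAddCircle) => φ q.2 1 (θ^[q.1] ω) x) P P

/-- `g : 𝕋 × 𝕋 → ℝ` is of class `C⁴`: its doubly 1-periodic lift to `ℝ × ℝ` is. -/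
def IsC4 (g : UnitAddCircle → UnitAddCircle → ℝ) : Prop :=
  ContDiff ℝ 4 (fun p : ℝ × ℝ => g (p.1 : UnitAddCircle) (p.2 : UnitAddCircle))

/-- The coupling functions `h (θ^t ω)` are random elements of `C⁴(𝕋², ℝ)` which are independent and
identically distributed in time `t`. Functions on `𝕋²` carry the σ-algebra generated by the
evaluations; on `C⁴(𝕋², ℝ)` this is the Borel σ-algebra. -/
structure IIDCoupling {Ω : Type*} [MeasurableSpace Ω] (P : Measure Ω) (θ : Ω → Ω)
    (h : Ω → UnitAddCircle → UnitAddCircle → ℝ) : Prop where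
  measurable : ∀ x y, Measurable (fun ω => h ω x y)
  smooth : ∀ ω, IsC4 (h ω)
  indep : iIndepFun (fun (t : ℕ) (ω : Ω) (x y : UnitAddCircle) => h (θ^[t] ω) x y) P
  ident : ∀ t s : ℕ,
    IdentDistrib (fun (ω : Ω) (x y : UnitAddCircle) => h (θ^[t] ω) x y)
      (fun (ω : Ω) (x y : UnitAddCircle) => h (θ^[s] ω) x y) P P

/-- `m` is a stationary probability measure of the Markov chain with transition probability
`P(x, B) = ℙ(φ(1, ω, x) ∈ B)`. -/
structure IsStationaryMeasure {Ω M : Type*} [MeasurableSpace Ω] [MeasurableSpace M] (P : Measure Ω)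
    (φ : ℕ → Ω → M → M) (m : Measure M) : Prop where
  isProb : IsProbabilityMeasure m
  stationary : ∀ B : Set M, MeasurableSet B → ∫⁻ x, P {ω | φ 1 ω x ∈ B} ∂m = m B

/-- `φ(1, ω, ·) ∘ φ(1, θ ω, ·) ∘ ⋯ ∘ φ(1, θ^(n-1) ω, ·)` applied to `p`. -/
def backwardIterate {Ω M : Type*} (θ : Ω → Ω) (φ : ℕ → Ω → M → M) (p : M) : ℕ → Ω → M
  | 0, _ => p
  | n + 1, ω => φ 1 ω (backwardIterate θ φ p n (θ ω))

/-- The coding map `π(ω) = lim_n φ(1, ω, ·) ∘ ⋯ ∘ φ(1, θ^(n-1) ω, p)`. For uniform contractions the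
limit exists and does not depend on the base point `p`; the base point used here is `0`. -/
noncomputable def codingMap {Ω : Type*} (θ : Ω → Ω) (φ : ℕ → Ω → UnitAddCircle → UnitAddCircle)
    (ω : Ω) : UnitAddCircle :=
  limUnder atTop (fun n : ℕ => backwardIterate θ φ 0 n ω)

/-- The push-forward `π_* ℙ` of the noise under the coding map. -/
noncomputable def codingMeasure {Ω : Type*} [MeasurableSpace Ω] (P : Measure Ω) (θ : Ω → Ω)
    (φ : ℕ → Ω → UnitAddCircle → UnitAddCircle) : Measure UnitAddCircle :=
  P.map (codingMap θ φ)

/-- `‖g‖_{C⁰} = sup |g|`. -/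
noncomputable def normC0 (g : UnitAddCircle → UnitAddCircle → ℝ) : ℝ :=
  ⨆ p : UnitAddCircle × UnitAddCircle, |g p.1 p.2|

/-- `|g|_Lip`, the smallest Lipschitz constant of `g` on `𝕋²` with the maximum distance. -/
noncomputable def lipConst (g : UnitAddCircle → UnitAddCircle → ℝ) : ℝ :=
  sInf {K : ℝ | 0 ≤ K ∧
    ∀ p q : UnitAddCircle × UnitAddCircle, |g p.1 p.2 - g q.1 q.2| ≤ K * dist p q}

/-- The partial derivative `∂₁^a ∂₂^b g`, as a doubly periodic function on `ℝ²`. -/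
noncomputable def mixedDeriv (g : UnitAddCircle → UnitAddCircle → ℝ) (a b : ℕ) (x y : ℝ) : ℝ :=
  iteratedDeriv a
    (fun s : ℝ => iteratedDeriv b (fun r : ℝ => g (s : UnitAddCircle) (r : UnitAddCircle)) y) x

/-- `‖g‖_{C⁴}`, the maximum over `a + b ≤ 4` of `sup |∂₁^a ∂₂^b g|`. -/
noncomputable def normC4 (g : UnitAddCircle → UnitAddCircle → ℝ) : ℝ :=
  sSup {r : ℝ | ∃ (a b : ℕ) (x y : ℝ), a + b ≤ 4 ∧ r = |mixedDeriv g a b x y|}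

section Star

variable {Ω : Type*} {L : ℕ}

/-- One step of the star network with hub `0` and low-degree nodes `1, …, L`. -/
noncomputable def starStep (φ : Fin (L + 1) → ℕ → Ω → UnitAddCircle → UnitAddCircle)
    (h : Ω → UnitAddCircle → UnitAddCircle → ℝ) (α : ℝ) (ω : Ω)
    (x : Fin (L + 1) → UnitAddCircle) : Fin (L + 1) → UnitAddCircle :=
  Fin.cons
    (φ 0 1 ω (x 0) + ((α * (1 / (L : ℝ) * ∑ j : Fin L, h ω (x 0) (x j.succ)) : ℝ) : UnitAddCircle))
    (fun j : Fin L =>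
      φ j.succ 1 ω (x j.succ) + ((α * (1 / (L : ℝ) * h ω (x j.succ) (x 0)) : ℝ) : UnitAddCircle))

/-- The star network trajectory `x^t = Φ_α(t, ω, x)`. -/
noncomputable def starOrbit (θ : Ω → Ω) (φ : Fin (L + 1) → ℕ → Ω → UnitAddCircle → UnitAddCircle)
    (h : Ω → UnitAddCircle → UnitAddCircle → ℝ) (α : ℝ) :
    ℕ → Ω → (Fin (L + 1) → UnitAddCircle) → Fin (L + 1) → UnitAddCircle
  | 0, _, x => x
  | t + 1, ω, x => starStep φ h α (θ^[t] ω) (starOrbit θ φ h α t ω x)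

/-- The mean-field reduced hub system `φ_{α,m}`, built from the hub map `φ₁`. -/
noncomputable def reducedHub (θ : Ω → Ω) (φ₁ : ℕ → Ω → UnitAddCircle → UnitAddCircle)
    (h : Ω → UnitAddCircle → UnitAddCircle → ℝ) (α : ℝ) (m : Measure UnitAddCircle) :
    ℕ → Ω → UnitAddCircle → UnitAddCircle
  | 0, _, z => z
  | t + 1, ω, z =>
    φ₁ 1 (θ^[t] ω) (reducedHub θ φ₁ h α m t ω z) +
      ((α * ∫ y, h (θ^[t] ω) (reducedHub θ φ₁ h α m t ω z) y ∂m : ℝ) : UnitAddCircle)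

/-- The fluctuation `ξ_m(ω, x)` of the coupling term of the hub around its mean-field value. -/
noncomputable def fluctuation (h : Ω → UnitAddCircle → UnitAddCircle → ℝ) (α : ℝ)
    (m : Measure UnitAddCircle) (ω : Ω) (x : Fin (L + 1) → UnitAddCircle) : ℝ :=
  α * (1 / (L : ℝ) * ∑ j : Fin L, h ω (x 0) (x j.succ) - ∫ y, h ω (x 0) y ∂m)

/-- `z^{t+1} = φ_{α,m}(1, θ^t ω, z^t) + ξ_m(θ^t ω, x^t) mod 1`. -/
theorem hub_eq_reducedHub_add_fluctuation (θ : Ω → Ω)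
    (φ : Fin (L + 1) → ℕ → Ω → UnitAddCircle → UnitAddCircle)
    (h : Ω → UnitAddCircle → UnitAddCircle → ℝ) (α : ℝ) (m : Measure UnitAddCircle)
    (t : ℕ) (ω : Ω) (x : Fin (L + 1) → UnitAddCircle) :
    starOrbit θ φ h α (t + 1) ω x 0 =
      reducedHub θ (φ 0) h α m 1 (θ^[t] ω) (starOrbit θ φ h α t ω x 0) +
        ((fluctuation h α m (θ^[t] ω) (starOrbit θ φ h α t ω x) : ℝ) : UnitAddCircle) := by
  simp only [starOrbit, starStep, reducedHub, fluctuation, Fin.cons_zero, Function.iterate_zero,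
    id_eq, add_assoc, ← AddCircle.coe_add]
  congr 2
  ring

/-- The hub admits `ε`-reduction to `φ_{α,m}` on initial data `(ω, x)` at time `t`. -/
def AdmitsReductionAt (θ : Ω → Ω) (φ : Fin (L + 1) → ℕ → Ω → UnitAddCircle → UnitAddCircle)
    (h : Ω → UnitAddCircle → UnitAddCircle → ℝ) (α : ℝ) (m : Measure UnitAddCircle) (ε : ℝ)
    (ω : Ω) (x : Fin (L + 1) → UnitAddCircle) (t : ℕ) : Prop :=
  |fluctuation h α m (θ^[t] ω) (starOrbit θ φ h α t ω x)| ≤ ε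

open scoped Classical in
/-- The hub admits `ε`-reduction to `φ_{α,m}` on initial data `(ω, x)` with exceptional frequency at
most `ρ`: the upper asymptotic frequency of the times without `ε`-reduction is at most `ρ`. -/
def AdmitsReduction (θ : Ω → Ω) (φ : Fin (L + 1) → ℕ → Ω → UnitAddCircle → UnitAddCircle)
    (h : Ω → UnitAddCircle → UnitAddCircle → ℝ) (α : ℝ) (m : Measure UnitAddCircle) (ε ρ : ℝ)
    (ω : Ω) (x : Fin (L + 1) → UnitAddCircle) : Prop :=
  limsup (fun T : ℕ =>
    (((Finset.range T).filter (fun t => ¬ AdmitsReductionAt θ φ h α m ε ω x t)).card : ℝ) / (T : ℝ))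
    atTop ≤ ρ

end Star

/-! ### One-variable derivative estimates -/

/-! Shadowing. Along the orbit of ω let A, B, H be the suprema of the C⁰ norm, the Lipschitz
constant and the C⁴ norm of h. The coupling moves a low-degree node by at most αA/L per step, while
its own map contracts by λ. At time s + n the node is therefore within αA/(L(1-λ)) + λ^n/2 of φ_j(n,
θ^s ω, 0), the uncoupled node restarted from 0 at time s (`dist_starOrbit_forward_le`). The
restarted nodes are independent over j, depend only on the noise in [s, s + n), and have laws
λ^n/2-close to m₀ on 1-Lipschitz observables (`abs_integral_forward_sub_le`). The same contraction
of the Markov operator gives uniqueness of the stationary measure; existence comes from π(ω) = φ(1,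
ω, π(θω)), where π(θω) is independent of the map at time 0.

Uniform concentration. The observable y ↦ h(θ^t ω, z^t, y) may be correlated with the nodes it is
averaged over, so concentration is needed for all B-Lipschitz C¹ observables at once. Outside a
single event, every Fourier coefficient of the empirical measure of the restarted nodes is within a
multiple of τ k^(1/4) of its mean. This growth in k is fast enough for Hoeffding and a union bound
over modes to give probability at most K exp(-Lτ²/2) (`measureReal_fourierDeviationSet_le`), and
slow enough for Parseval to bound the error of every such observable by 0.56 Bτ
(`abs_integral_sub_integral_le_of_fourier`).

Frequency. A bad time s + n forces θ^s ω into this event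
(`mem_deviationEvent_of_lt_abs_fluctuation`). Since the event sees only n steps of noise, the strong
law along residue classes mod n bounds its visit frequency by its probability
(`ae_eventually_sum_range_le`). The event involves neither x nor the orbit of h, so one null set
serves all x.

Constants. Periodicity gives 32 B ≤ H, whence 450; the interpolation B² ≤ 32 A H and the lower bound
on ε turn the prefactor into a multiple of H/ε (`deviation_bound_le`). -/

theorem sq_deriv_le_of_bounds {f f' f'' : ℝ → ℝ} {A M : ℝ} (hM : 0 ≤ M)
    (hf : ∀ x, HasDerivAt f (f' x) x) (hf' : ∀ x, HasDerivAt f' (f'' x) x)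
    (hA : ∀ x, |f x| ≤ A) (hB : ∀ x, |f'' x| ≤ M) (x : ℝ) : f' x ^ 2 ≤ 8 * A * M := by
  have hA0 : 0 ≤ A := (abs_nonneg _).trans (hA 0)
  -- The mean value theorem on [x, x + s] gives |f' x| ≤ 2A/s + Ms for s > 0. Multiplied by s this
  -- is a quadratic inequality valid for all s, so the discriminant is nonpositive.
  have key : ∀ s : ℝ, 0 ≤ M * (s * s) + (-|f' x|) * s + 2 * A := by
    intro s
    rcases le_or_gt s 0 with hs | hs
    · have := mul_nonneg (abs_nonneg (f' x)) (neg_nonneg.2 hs)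
      nlinarith [mul_nonneg hM (mul_self_nonneg s)]
    · obtain ⟨ξ, hξ, he⟩ := exists_hasDerivAt_eq_slope f f' (lt_add_of_pos_right x hs)
        (fun y _ => (hf y).continuousAt.continuousWithinAt) (fun y _ => hf y)
      have h1 : f' ξ * s = f (x + s) - f x := by
        rw [he, add_sub_cancel_left, div_mul_cancel₀ _ hs.ne']
      have h2 : |f' ξ - f' x| ≤ M * s := by
        have := Convex.norm_image_sub_le_of_norm_hasDerivWithin_le (f := f') (f' := f'') (C := M)
          (s := Set.univ) (x := x) (y := ξ) (fun y _ => (hf' y).hasDerivWithinAt)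
          (fun y _ => hB y) convex_univ (Set.mem_univ _) (Set.mem_univ _)
        simp only [Real.norm_eq_abs] at this
        rw [abs_of_pos (sub_pos.2 hξ.1)] at this
        exact this.trans (mul_le_mul_of_nonneg_left (by linarith [hξ.2]) hM)
      have h3 : |f' ξ| * s ≤ 2 * A := by
        rw [show |f' ξ| * s = |f' ξ * s| by rw [abs_mul, abs_of_pos hs], h1]
        exact (abs_sub _ _).trans (by linarith [hA (x + s), hA x])
      have h4 : |f' x| ≤ |f' ξ| + M * s := by
        have := abs_sub_abs_le_abs_sub (f' x) (f' ξ)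
        rw [abs_sub_comm] at this
        linarith
      nlinarith [mul_le_mul_of_nonneg_right h4 hs.le]
  have := discrim_le_zero key
  rw [discrim, neg_sq, sq_abs] at this
  linarith

/-- Over a period f' has mean zero, so f'(x) is the mean of f'(x) - f'(x + s) over |s| ≤ 1/2, and
M|s| has mean M/4. In place of the integral, M s² ± (2 s f'(x) - f(x + s) + f(x - s)) is shown to be
monotone in s ≥ 0; it goes from 0 at s = 0 to M/4 ± f'(x) at s = 1/2. -/
theorem abs_deriv_le_of_periodic {f f' f'' : ℝ → ℝ} {M : ℝ}
    (hf : ∀ x, HasDerivAt f (f' x) x) (hf' : ∀ x, HasDerivAt f' (f'' x) x)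
    (hper : Function.Periodic f 1) (hB : ∀ x, |f'' x| ≤ M) (x : ℝ) : |f' x| ≤ M / 4 := by
  have hlip : ∀ s : ℝ, 0 ≤ s → |f' (x + s) - f' x| ≤ M * s ∧ |f' (x - s) - f' x| ≤ M * s := by
    intro s hs
    have h := fun y => Convex.norm_image_sub_le_of_norm_hasDerivWithin_le (f := f') (f' := f'')
      (C := M) (s := Set.univ) (x := x) (y := y) (fun y _ => (hf' y).hasDerivWithinAt)
      (fun y _ => hB y) convex_univ (Set.mem_univ _) (Set.mem_univ _)
    have h1 := h (x + s)
    have h2 := h (x - s)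
    simp only [Real.norm_eq_abs, add_sub_cancel_left, sub_sub_cancel_left, abs_neg,
      abs_of_nonneg hs] at h1 h2
    exact ⟨h1, h2⟩
  have h0 : f (x + 1 / 2) - f (x - 1 / 2) = 0 := by
    have := hper (x - 1 / 2)
    rw [show x - 1 / 2 + 1 = x + 1 / 2 by ring] at this
    rw [this, sub_self]
  have hd : ∀ (c s : ℝ), HasDerivAt (fun s => M * s ^ 2 + c * (2 * s * f' x - (f (x + s) - f (x - s))))
      (M * (2 * s) + c * (2 * f' x - (f' (x + s) + f' (x - s)))) s := by
    intro c s
    have e1 : HasDerivAt (fun s => f (x + s)) (f' (x + s)) s := by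
      simpa using (hf (x + s)).comp_const_add x s
    have e2 : HasDerivAt (fun s => f (x - s)) (-f' (x - s)) s := by
      simpa using (hf (x - s)).comp_const_sub x s
    have e3 : HasDerivAt (fun s : ℝ => M * s ^ 2) (M * (2 * s)) s := by
      simpa using (hasDerivAt_pow 2 s).const_mul M
    have e4 : HasDerivAt (fun s : ℝ => 2 * s * f' x) (2 * f' x) s := by
      simpa using ((hasDerivAt_id s).const_mul 2).mul_const (f' x)
    refine (e3.add ((e4.sub (e1.sub e2)).const_mul c)).congr_deriv ?_
    ring
  have hmono : ∀ c : ℝ, |c| = 1 → 0 ≤ M * (1 / 2 : ℝ) ^ 2 + c * f' x := by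
    intro c hc
    have := monotoneOn_of_hasDerivWithinAt_nonneg (convex_Ici (0 : ℝ))
      (f := fun s => M * s ^ 2 + c * (2 * s * f' x - (f (x + s) - f (x - s))))
      (fun s _ => (hd c s).continuousAt.continuousWithinAt)
      (fun s _ => (hd c s).hasDerivWithinAt)
      (by
        intro s hs
        rw [interior_Ici, Set.mem_Ioi] at hs
        obtain ⟨h1, h2⟩ := hlip s hs.le
        have : |c * (2 * f' x - (f' (x + s) + f' (x - s)))| ≤ M * (2 * s) := by
          rw [abs_mul, hc, one_mul]
          rw [show 2 * f' x - (f' (x + s) + f' (x - s))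
            = -(f' (x + s) - f' x) - (f' (x - s) - f' x) by ring]
          refine (abs_sub _ _).trans ?_
          rw [abs_neg]
          linarith
        linarith [neg_abs_le (c * (2 * f' x - (f' (x + s) + f' (x - s))))])
      (Set.mem_Ici.2 le_rfl) (Set.mem_Ici.2 (by norm_num : (0 : ℝ) ≤ 1 / 2)) (by norm_num)
    simp only [h0, add_zero, sub_zero, mul_zero, zero_mul, sub_self] at this
    norm_num at this ⊢
    exact this
  have h1 := hmono 1 (by simp)
  have h2 := hmono (-1) (by simp)
  rw [abs_le]
  constructor <;> linarith

theorem hasDerivAt_iteratedDeriv_of_contDiff {f : ℝ → ℝ} {n k : ℕ} (hf : ContDiff ℝ n f) (hk : k < n)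
    (x : ℝ) : HasDerivAt (iteratedDeriv k f) (iteratedDeriv (k + 1) f x) x := by
  rw [iteratedDeriv_succ]
  exact ((hf.differentiable_iteratedDeriv k (by exact_mod_cast hk)) x).hasDerivAt

theorem periodic_iteratedDeriv {f : ℝ → ℝ} (hf : Function.Periodic f 1) (k : ℕ) :
    Function.Periodic (iteratedDeriv k f) 1 := by
  intro x
  have := congrFun (iteratedDeriv_comp_add_const k f 1) x
  rw [← this]
  congr 1
  exact funext hf

/-- Each of the three descents from the fourth derivative to the first gains a factor 1/4. Adding
the two variables later turns 64 into the 32 behind the constant 450. -/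
theorem abs_deriv_le_of_periodic_of_four {f : ℝ → ℝ} (hf : ContDiff ℝ 4 f)
    (hper : Function.Periodic f 1) {H : ℝ} (hH : ∀ x, |iteratedDeriv 4 f x| ≤ H) (x : ℝ) :
    |iteratedDeriv 1 f x| ≤ H / 64 := by
  have hd := fun k hk => hasDerivAt_iteratedDeriv_of_contDiff (n := 4) (k := k) hf hk
  have h3 := abs_deriv_le_of_periodic (hd 2 (by norm_num)) (hd 3 (by norm_num))
    (periodic_iteratedDeriv hper 2) hH
  have h2 := abs_deriv_le_of_periodic (hd 1 (by norm_num)) (hd 2 (by norm_num))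
    (periodic_iteratedDeriv hper 1) h3
  have h1 := abs_deriv_le_of_periodic (hd 0 (by norm_num)) (hd 1 (by norm_num))
    (periodic_iteratedDeriv hper 0) h2 x
  linarith

/-! ### Lipschitz functions on the circle -/

/-- Lifting along the shorter arc transfers mean value estimates on ℝ to the circle distance. -/
theorem UnitAddCircle.exists_coe_add_eq (p q : UnitAddCircle) :
    ∃ x s : ℝ, (x : UnitAddCircle) = p ∧ ((x + s : ℝ) : UnitAddCircle) = q ∧ |s| = dist p q := by
  obtain ⟨x, rfl⟩ := QuotientAddGroup.mk_surjective p
  obtain ⟨u, hu⟩ := QuotientAddGroup.mk_surjective (q - (x : UnitAddCircle))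
  refine ⟨x, u - round u, rfl, ?_, ?_⟩
  · have h1 : ((round u : ℝ) : UnitAddCircle) = 0 := by
      rw [AddCircle.coe_eq_zero_iff]
      exact ⟨round u, by simp⟩
    have hu' : (u : UnitAddCircle) = q - (x : UnitAddCircle) := hu
    rw [AddCircle.coe_add, AddCircle.coe_sub, h1, hu', sub_zero, add_sub_cancel]
  · rw [dist_comm, dist_eq_norm]
    have hu' : (u : UnitAddCircle) = q - (x : UnitAddCircle) := hu
    change _ = ‖q - (x : UnitAddCircle)‖
    rw [← hu', UnitAddCircle.norm_eq]

theorem UnitAddCircle.dist_le_half (p q : UnitAddCircle) : dist p q ≤ 1 / 2 := by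
  rw [dist_eq_norm]
  have := AddCircle.norm_le_half_period (1 : ℝ) (x := p - q) one_ne_zero
  simpa using this

theorem UnitAddCircle.abs_sub_le_of_abs_deriv_le {g : UnitAddCircle → ℝ} {g' : ℝ → ℝ} {β : ℝ}
    (hg : ∀ x, HasDerivAt (fun x : ℝ => g x) (g' x) x) (hβ : ∀ x, |g' x| ≤ β)
    (p q : UnitAddCircle) : |g p - g q| ≤ β * dist p q := by
  obtain ⟨x, s, rfl, rfl, hs⟩ := UnitAddCircle.exists_coe_add_eq p q
  rw [← hs]
  have := Convex.norm_image_sub_le_of_norm_hasDerivWithin_le (f := fun x : ℝ => g x) (f' := g')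
    (C := β) (s := Set.univ) (x := x + s) (y := x) (fun y _ => (hg y).hasDerivWithinAt)
    (fun y _ => hβ y) convex_univ (Set.mem_univ _) (Set.mem_univ _)
  simpa using this

/-! ### Partial derivatives -/

theorem ContDiff.iteratedDeriv_snd {F : ℝ × ℝ → ℝ} {m : ℕ} (b : ℕ) (hF : ContDiff ℝ (m + b : ℕ) F) :
    ContDiff ℝ m (fun p : ℝ × ℝ => iteratedDeriv b (fun r => F (p.1, r)) p.2) := by
  induction b generalizing m with
  | zero => simpa using hF
  | succ b ih =>
    have h1 : ContDiff ℝ ((m + 1 : ℕ)) (fun p : ℝ × ℝ => iteratedDeriv b (fun r => F (p.1, r)) p.2) :=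
      ih (by rwa [show m + 1 + b = m + (b + 1) by ring])
    have h2 : (fun p : ℝ × ℝ => iteratedDeriv (b + 1) (fun r => F (p.1, r)) p.2) =
        fun p => fderiv ℝ (fun p : ℝ × ℝ => iteratedDeriv b (fun r => F (p.1, r)) p.2) p (0, 1) := by
      funext p
      rw [iteratedDeriv_succ]
      have hd := (h1.differentiable (by simp) p).hasFDerivAt
      have hc : HasDerivAt (fun r : ℝ => (p.1, r)) ((0 : ℝ), (1 : ℝ)) p.2 :=
        (hasDerivAt_const _ _).prodMk (hasDerivAt_id _)
      exact (HasFDerivAt.comp_hasDerivAt (f := fun r : ℝ => (p.1, r)) p.2 hd hc).deriv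
    rw [h2]
    exact (h1.fderiv_right (m := m) (by norm_cast)).clm_apply contDiff_const

theorem ContDiff.iteratedDeriv_fst {F : ℝ × ℝ → ℝ} {m : ℕ} (b : ℕ) (hF : ContDiff ℝ (m + b : ℕ) F) :
    ContDiff ℝ m (fun p : ℝ × ℝ => iteratedDeriv b (fun r => F (r, p.2)) p.1) := by
  have h1 : ContDiff ℝ (m + b : ℕ) (fun p : ℝ × ℝ => F (p.2, p.1)) :=
    hF.comp (contDiff_snd.prodMk contDiff_fst)
  exact (ContDiff.iteratedDeriv_snd b h1).comp (contDiff_snd.prodMk contDiff_fst)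

theorem IsC4.continuous_mixedDeriv {g : UnitAddCircle → UnitAddCircle → ℝ} (hg : IsC4 g) {a b : ℕ}
    (hab : a + b ≤ 4) : Continuous (fun p : ℝ × ℝ => mixedDeriv g a b p.1 p.2) := by
  obtain ⟨c, hc⟩ := Nat.exists_eq_add_of_le hab
  have h1 : ContDiff ℝ ((c + a) + b : ℕ)
      (fun p : ℝ × ℝ => g (p.1 : UnitAddCircle) (p.2 : UnitAddCircle)) := by
    have h4 : c + a + b = 4 := by omega
    rw [h4]
    exact hg
  exact (ContDiff.iteratedDeriv_fst (m := c) a (ContDiff.iteratedDeriv_snd (m := c + a) b h1)).continuous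

theorem mixedDeriv_periodic_left (g : UnitAddCircle → UnitAddCircle → ℝ) (a b : ℕ) (y : ℝ) :
    Function.Periodic (fun x => mixedDeriv g a b x y) 1 := by
  refine periodic_iteratedDeriv ?_ a
  intro x
  simp

theorem mixedDeriv_periodic_right (g : UnitAddCircle → UnitAddCircle → ℝ) (a b : ℕ) (x : ℝ) :
    Function.Periodic (fun y => mixedDeriv g a b x y) 1 := by
  intro y
  refine congrArg (fun F => iteratedDeriv a F x) (funext fun s => ?_)
  exact periodic_iteratedDeriv (fun r => by simp) b y

theorem IsC4.exists_bound_mixedDeriv {g : UnitAddCircle → UnitAddCircle → ℝ} (hg : IsC4 g) {a b : ℕ}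
    (hab : a + b ≤ 4) : ∃ M, ∀ x y, |mixedDeriv g a b x y| ≤ M := by
  obtain ⟨M, hM⟩ := (isCompact_Icc.prod isCompact_Icc : IsCompact (Set.Icc (0 : ℝ) 1 ×ˢ Set.Icc (0 : ℝ) 1)).exists_bound_of_continuousOn
    (hg.continuous_mixedDeriv hab).continuousOn
  refine ⟨M, fun x y => ?_⟩
  have hx := (mixedDeriv_periodic_left g a b y).sub_int_mul_eq (x := x) ⌊x⌋
  have hy := (mixedDeriv_periodic_right g a b (x - ⌊x⌋ * 1)).sub_int_mul_eq (x := y) ⌊y⌋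
  simp only [mul_one] at hx hy
  rw [← hx, ← hy]
  refine hM (x - ⌊x⌋, y - ⌊y⌋) ⟨⟨?_, ?_⟩, ⟨?_, ?_⟩⟩
  · exact Int.fract_nonneg x
  · exact (Int.fract_lt_one x).le
  · exact Int.fract_nonneg y
  · exact (Int.fract_lt_one y).le

/-- A real `sSup` over an unbounded set is 0, so boundedness must come first: compactness of a
period square, for each of the finitely many pairs (a, b). -/
theorem IsC4.abs_mixedDeriv_le_normC4 {g : UnitAddCircle → UnitAddCircle → ℝ} (hg : IsC4 g) {a b : ℕ}
    (hab : a + b ≤ 4) (x y : ℝ) : |mixedDeriv g a b x y| ≤ normC4 g := by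
  refine le_csSup ?_ ⟨a, b, x, y, hab, rfl⟩
  have : ∀ q : ℕ × ℕ, ∃ M, q.1 + q.2 ≤ 4 → ∀ x y, |mixedDeriv g q.1 q.2 x y| ≤ M := by
    intro q
    by_cases hq : q.1 + q.2 ≤ 4
    · obtain ⟨M, hM⟩ := hg.exists_bound_mixedDeriv hq
      exact ⟨M, fun _ => hM⟩
    · exact ⟨0, fun h => absurd h hq⟩
  choose M hM using this
  refine ⟨∑ q ∈ Finset.range 5 ×ˢ Finset.range 5, |M q|, ?_⟩
  rintro _ ⟨a, b, x, y, hab, rfl⟩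
  refine (hM (a, b) hab x y).trans ((le_abs_self _).trans ?_)
  refine Finset.single_le_sum (f := fun q => |M q|) (fun _ _ => abs_nonneg _) ?_
  simp only [Finset.mem_product, Finset.mem_range]
  omega

theorem IsC4.normC4_nonneg {g : UnitAddCircle → UnitAddCircle → ℝ} (hg : IsC4 g) : 0 ≤ normC4 g :=
  (abs_nonneg _).trans (hg.abs_mixedDeriv_le_normC4 (a := 0) (b := 0) (by norm_num) 0 0)

theorem IsC4.abs_le_normC4 {g : UnitAddCircle → UnitAddCircle → ℝ} (hg : IsC4 g) (p q : UnitAddCircle) :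
    |g p q| ≤ normC4 g := by
  obtain ⟨x, rfl⟩ := QuotientAddGroup.mk_surjective p
  obtain ⟨y, rfl⟩ := QuotientAddGroup.mk_surjective q
  have := hg.abs_mixedDeriv_le_normC4 (a := 0) (b := 0) (by norm_num) x y
  simpa [mixedDeriv] using this

theorem IsC4.abs_le_normC0 {g : UnitAddCircle → UnitAddCircle → ℝ} (hg : IsC4 g) (p q : UnitAddCircle) :
    |g p q| ≤ normC0 g :=
  le_ciSup (f := fun p : UnitAddCircle × UnitAddCircle => |g p.1 p.2|)
    ⟨normC4 g, by rintro _ ⟨p, rfl⟩; exact hg.abs_le_normC4 _ _⟩ (p, q)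

theorem IsC4.normC0_le_normC4 {g : UnitAddCircle → UnitAddCircle → ℝ} (hg : IsC4 g) :
    normC0 g ≤ normC4 g :=
  ciSup_le fun p => hg.abs_le_normC4 p.1 p.2

theorem IsC4.contDiff_left {g : UnitAddCircle → UnitAddCircle → ℝ} (hg : IsC4 g) (y : ℝ) :
    ContDiff ℝ 4 (fun x : ℝ => g (x : UnitAddCircle) (y : UnitAddCircle)) :=
  ContDiff.comp hg (contDiff_id.prodMk contDiff_const)

theorem IsC4.contDiff_right {g : UnitAddCircle → UnitAddCircle → ℝ} (hg : IsC4 g) (x : ℝ) :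
    ContDiff ℝ 4 (fun y : ℝ => g (x : UnitAddCircle) (y : UnitAddCircle)) :=
  ContDiff.comp (g := fun p : ℝ × ℝ => g (p.1 : UnitAddCircle) (p.2 : UnitAddCircle)) hg
    (contDiff_const.prodMk contDiff_id)

theorem IsC4.abs_sub_le_of_deriv_le {g : UnitAddCircle → UnitAddCircle → ℝ} (hg : IsC4 g) {β : ℝ}
    (h1 : ∀ x y, |mixedDeriv g 1 0 x y| ≤ β) (h2 : ∀ x y, |mixedDeriv g 0 1 x y| ≤ β)
    (p q : UnitAddCircle × UnitAddCircle) : |g p.1 p.2 - g q.1 q.2| ≤ 2 * β * dist p q := by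
  have hβ : 0 ≤ β := (abs_nonneg _).trans (h1 0 0)
  have e1 : |g p.1 p.2 - g q.1 p.2| ≤ β * dist p.1 q.1 := by
    obtain ⟨y, hy⟩ := QuotientAddGroup.mk_surjective p.2
    rw [← hy]
    refine UnitAddCircle.abs_sub_le_of_abs_deriv_le (g := fun z => g z (y : UnitAddCircle))
      (g' := fun x => mixedDeriv g 1 0 x y) (fun x => ?_) (fun x => h1 x y) p.1 q.1
    simpa [mixedDeriv] using hasDerivAt_iteratedDeriv_of_contDiff (n := 4) (k := 0)
      (hg.contDiff_left y) (by norm_num) x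
  have e2 : |g q.1 p.2 - g q.1 q.2| ≤ β * dist p.2 q.2 := by
    obtain ⟨x, hx⟩ := QuotientAddGroup.mk_surjective q.1
    rw [← hx]
    refine UnitAddCircle.abs_sub_le_of_abs_deriv_le (g := fun z => g (x : UnitAddCircle) z)
      (g' := fun y => mixedDeriv g 0 1 x y) (fun y => ?_) (fun y => h2 x y) p.2 q.2
    simpa [mixedDeriv] using hasDerivAt_iteratedDeriv_of_contDiff (n := 4) (k := 0)
      (hg.contDiff_right x) (by norm_num) y
  have d1 : dist p.1 q.1 ≤ dist p q := le_max_left _ _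
  have d2 : dist p.2 q.2 ≤ dist p q := le_max_right _ _
  calc |g p.1 p.2 - g q.1 q.2| ≤ |g p.1 p.2 - g q.1 p.2| + |g q.1 p.2 - g q.1 q.2| :=
        abs_sub_le _ _ _
    _ ≤ β * dist p q + β * dist p q := by
        gcongr
        · exact e1.trans (by gcongr)
        · exact e2.trans (by gcongr)
    _ = 2 * β * dist p q := by ring

theorem IsC4.abs_mixedDeriv_one_le {g : UnitAddCircle → UnitAddCircle → ℝ} (hg : IsC4 g) (x y : ℝ) :
    |mixedDeriv g 1 0 x y| ≤ normC4 g / 64 ∧ |mixedDeriv g 0 1 x y| ≤ normC4 g / 64 := by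
  constructor
  · have := abs_deriv_le_of_periodic_of_four (hg.contDiff_left y) (fun x => by simp)
      (H := normC4 g) (fun x => ?_) x
    · simpa [mixedDeriv] using this
    · simpa [mixedDeriv] using hg.abs_mixedDeriv_le_normC4 (a := 4) (b := 0) (by norm_num) x y
  · have := abs_deriv_le_of_periodic_of_four (hg.contDiff_right x) (fun x => by simp)
      (H := normC4 g) (fun y => ?_) y
    · simpa [mixedDeriv] using this
    · simpa [mixedDeriv] using hg.abs_mixedDeriv_le_normC4 (a := 0) (b := 4) (by norm_num) x y

theorem IsC4.sq_mixedDeriv_one_le {g : UnitAddCircle → UnitAddCircle → ℝ} (hg : IsC4 g) (x y : ℝ) :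
    mixedDeriv g 1 0 x y ^ 2 ≤ 8 * normC0 g * normC4 g ∧
      mixedDeriv g 0 1 x y ^ 2 ≤ 8 * normC0 g * normC4 g := by
  constructor
  · have hd := fun k hk => hasDerivAt_iteratedDeriv_of_contDiff (n := 4) (k := k)
      (hg.contDiff_left y) hk
    have := sq_deriv_le_of_bounds hg.normC4_nonneg (hd 0 (by norm_num)) (hd 1 (by norm_num))
      (A := normC0 g) (fun x => by simpa using hg.abs_le_normC0 _ _) (fun x => ?_) x
    · simpa [mixedDeriv] using this
    · simpa [mixedDeriv] using hg.abs_mixedDeriv_le_normC4 (a := 2) (b := 0) (by norm_num) x y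
  · have hd := fun k hk => hasDerivAt_iteratedDeriv_of_contDiff (n := 4) (k := k)
      (hg.contDiff_right x) hk
    have := sq_deriv_le_of_bounds hg.normC4_nonneg (hd 0 (by norm_num)) (hd 1 (by norm_num))
      (A := normC0 g) (fun y => by simpa using hg.abs_le_normC0 _ _) (fun y => ?_) y
    · simpa [mixedDeriv] using this
    · simpa [mixedDeriv] using hg.abs_mixedDeriv_le_normC4 (a := 0) (b := 2) (by norm_num) x y

/-! ### The Lipschitz constant against the C⁰ and C⁴ norms -/

theorem lipConst_nonneg (g : UnitAddCircle → UnitAddCircle → ℝ) : 0 ≤ lipConst g :=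
  Real.sInf_nonneg fun _ h => h.1

theorem lipConst_le {g : UnitAddCircle → UnitAddCircle → ℝ} {K : ℝ} (hK : 0 ≤ K)
    (h : ∀ p q : UnitAddCircle × UnitAddCircle, |g p.1 p.2 - g q.1 q.2| ≤ K * dist p q) :
    lipConst g ≤ K :=
  csInf_le ⟨0, fun _ h => h.1⟩ ⟨hK, h⟩

theorem IsC4.lipConst_le_of_deriv_le {g : UnitAddCircle → UnitAddCircle → ℝ} (hg : IsC4 g) {β : ℝ}
    (h1 : ∀ x y, |mixedDeriv g 1 0 x y| ≤ β) (h2 : ∀ x y, |mixedDeriv g 0 1 x y| ≤ β) :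
    lipConst g ≤ 2 * β :=
  lipConst_le (by linarith [(abs_nonneg _).trans (h1 0 0)]) (hg.abs_sub_le_of_deriv_le h1 h2)

theorem IsC4.lipConst_le_normC4 {g : UnitAddCircle → UnitAddCircle → ℝ} (hg : IsC4 g) :
    lipConst g ≤ normC4 g / 32 := by
  have := hg.lipConst_le_of_deriv_le (fun x y => (hg.abs_mixedDeriv_one_le x y).1)
    (fun x y => (hg.abs_mixedDeriv_one_le x y).2)
  linarith

/-- Interpolation between the function and its second derivatives. It trades a factor B² for A H, so
that the lower bound on ε, which involves A B, can control the prefactor. -/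
theorem IsC4.sq_lipConst_le {g : UnitAddCircle → UnitAddCircle → ℝ} (hg : IsC4 g) :
    lipConst g ^ 2 ≤ 32 * normC0 g * normC4 g := by
  have h0 : 0 ≤ 8 * normC0 g * normC4 g :=
    (sq_nonneg _).trans (hg.sq_mixedDeriv_one_le 0 0).1
  have := hg.lipConst_le_of_deriv_le (fun x y => Real.abs_le_sqrt (hg.sq_mixedDeriv_one_le x y).1)
    (fun x y => Real.abs_le_sqrt (hg.sq_mixedDeriv_one_le x y).2)
  calc lipConst g ^ 2 ≤ (2 * √(8 * normC0 g * normC4 g)) ^ 2 :=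
        pow_le_pow_left₀ (lipConst_nonneg g) this 2
    _ = 32 * normC0 g * normC4 g := by rw [mul_pow, Real.sq_sqrt h0]; ring

theorem IsC4.abs_sub_le_lipConst {g : UnitAddCircle → UnitAddCircle → ℝ} (hg : IsC4 g)
    (p q : UnitAddCircle × UnitAddCircle) : |g p.1 p.2 - g q.1 q.2| ≤ lipConst g * dist p q := by
  rcases (dist_nonneg (x := p) (y := q)).eq_or_lt with h | h
  · have := hg.abs_sub_le_of_deriv_le (fun x y => (hg.abs_mixedDeriv_one_le x y).1)
      (fun x y => (hg.abs_mixedDeriv_one_le x y).2) p q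
    rw [← h, mul_zero] at this ⊢
    exact this
  · rw [← div_le_iff₀ h]
    refine le_csInf ⟨2 * (normC4 g / 64), ?_, ?_⟩ ?_
    · linarith [hg.normC4_nonneg]
    · exact hg.abs_sub_le_of_deriv_le (fun x y => (hg.abs_mixedDeriv_one_le x y).1)
        (fun x y => (hg.abs_mixedDeriv_one_le x y).2)
    · rintro K ⟨-, hK⟩
      rw [div_le_iff₀ h]
      exact hK p q

/-! ### Lipschitz observables and Fourier coefficients of measures on the circle -/

theorem sum_range_inv_mul_sqrt_le (n : ℕ) :
    ∑ i ∈ Finset.range n, (((i : ℝ) + 1) * √((i : ℝ) + 1))⁻¹ ≤ 3 := by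
  -- The tail term 2/√(n + 1), the integral of x^(-3/2) beyond n + 1, makes the induction telescope.
  suffices h : ∀ n : ℕ, ∑ i ∈ Finset.range (n + 1), (((i : ℝ) + 1) * √((i : ℝ) + 1))⁻¹
      ≤ 3 - 2 / √((n : ℝ) + 1) by
    rcases n with _ | n
    · simp
    · exact (h n).trans (by linarith [show 0 ≤ 2 / √((n : ℝ) + 1) by positivity])
  intro n
  induction n with
  | zero => norm_num
  | succ n ih =>
    rw [Finset.sum_range_succ]
    refine (add_le_add_left ih _).trans ?_
    push_cast
    set a := √((n : ℝ) + 1) with ha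
    set b := √((n : ℝ) + 1 + 1) with hb
    have ha0 : 0 < a := Real.sqrt_pos.2 (by positivity)
    have hab : a ≤ b := Real.sqrt_le_sqrt (by linarith)
    have hb0 : 0 < b := ha0.trans_le hab
    have hb2 : (n : ℝ) + 1 + 1 = b ^ 2 := (Real.sq_sqrt (by positivity)).symm
    have ha2 : (n : ℝ) + 1 = a ^ 2 := (Real.sq_sqrt (by positivity)).symm
    have h1 : (b - a) * (b + a) = 1 := by linarith [hb2, ha2, (by ring : (b - a) * (b + a) = b ^ 2 - a ^ 2)]
    have h2 : 2 / a - 2 / b = 2 / (a * b * (b + a)) := by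
      field_simp
      linarith
    have h3 : (b ^ 2 * b)⁻¹ ≤ 2 / (a * b * (b + a)) := by
      rw [inv_eq_one_div, div_le_div_iff₀ (by positivity) (by positivity)]
      have : a * (b + a) ≤ b * (b + b) := by gcongr
      nlinarith
    rw [hb2]
    linarith

theorem summable_int_inv_mul_sqrt :
    Summable (fun k : ℤ => (|(k : ℝ)| * √|(k : ℝ)|)⁻¹) ∧
      ∑' k : ℤ, (|(k : ℝ)| * √|(k : ℝ)|)⁻¹ ≤ 6 := by
  have hs : Summable (fun i : ℕ => (((i : ℝ) + 1) * √((i : ℝ) + 1))⁻¹) :=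
    summable_of_sum_range_le (fun i => by positivity) sum_range_inv_mul_sqrt_le
  have ht : ∑' i : ℕ, (((i : ℝ) + 1) * √((i : ℝ) + 1))⁻¹ ≤ 3 :=
    Real.tsum_le_of_sum_range_le (fun i => by positivity) sum_range_inv_mul_sqrt_le
  have h1 : HasSum (fun n : ℕ => (|((n : ℤ) : ℝ)| * √|((n : ℤ) : ℝ)|)⁻¹)
      (∑' i : ℕ, (((i : ℝ) + 1) * √((i : ℝ) + 1))⁻¹) := by
    rw [← hasSum_nat_add_iff' 1]
    simp only [Finset.range_one, Finset.sum_singleton, Nat.cast_zero, Int.cast_zero, abs_zero,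
      zero_mul, inv_zero, sub_zero]
    refine hs.hasSum.congr_fun fun i => ?_
    have : |(((i + 1 : ℕ) : ℤ) : ℝ)| = (i : ℝ) + 1 := by
      push_cast
      exact abs_of_nonneg (by positivity)
    rw [this]
  have h2 : HasSum (fun n : ℕ => (|((-((n : ℤ) + 1) : ℤ) : ℝ)| * √|((-((n : ℤ) + 1) : ℤ) : ℝ)|)⁻¹)
      (∑' i : ℕ, (((i : ℝ) + 1) * √((i : ℝ) + 1))⁻¹) := by
    refine hs.hasSum.congr_fun fun i => ?_
    have : |((-((i : ℤ) + 1) : ℤ) : ℝ)| = (i : ℝ) + 1 := by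
      push_cast
      rw [abs_neg]
      exact abs_of_nonneg (by positivity)
    rw [this]
  have h := HasSum.of_nat_of_neg_add_one (f := fun k : ℤ => (|(k : ℝ)| * √|(k : ℝ)|)⁻¹) h1 h2
  refine ⟨h.summable, ?_⟩
  rw [h.tsum_eq]
  linarith

/-- Integration by parts; the boundary term vanishes because f lives on the circle. -/
theorem fourierCoeff_eq_of_hasDerivAt {f : UnitAddCircle → ℂ} {f' : ℝ → ℂ}
    (hf : ∀ x : ℝ, HasDerivAt (fun x : ℝ => f x) (f' x) x) (hf' : Continuous f') {k : ℤ} (hk : k ≠ 0) :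
    ‖fourierCoeff f k‖ = ‖fourierCoeffOn zero_lt_one f' k‖ / (2 * Real.pi * |(k : ℝ)|) := by
  have e1 : fourierCoeff f k = fourierCoeffOn zero_lt_one (fun x : ℝ => f x) k := by
    rw [fourierCoeff_eq_intervalIntegral f k 0, fourierCoeffOn_eq_integral]
    simp
  have e2 := fourierCoeffOn_of_hasDerivAt (f := fun x : ℝ => f x) (f' := f') zero_lt_one hk
    (fun x _ => hf x) (hf'.intervalIntegrable 0 1)
  have e3 : f ((1 : ℝ) : UnitAddCircle) - f ((0 : ℝ) : UnitAddCircle) = 0 := by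
    rw [AddCircle.coe_period]
    simp
  rw [e1, e2, e3]
  simp [abs_of_pos Real.pi_pos]
  ring

theorem sum_sq_fourierCoeffOn_le {f' : ℝ → ℂ} (hf' : Continuous f') {B : ℝ} (hB : ∀ x, ‖f' x‖ ≤ B) :
    Summable (fun k : ℤ => ‖fourierCoeffOn zero_lt_one f' k‖ ^ 2) ∧
      ∑' k : ℤ, ‖fourierCoeffOn zero_lt_one f' k‖ ^ 2 ≤ B ^ 2 := by
  have hL2 : MemLp f' 2 (volume.restrict (Set.Ioc (0 : ℝ) 1)) :=
    MemLp.of_bound hf'.aestronglyMeasurable B (Eventually.of_forall hB)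
  have h := hasSum_sq_fourierCoeffOn zero_lt_one hL2
  refine ⟨h.summable, ?_⟩
  rw [h.tsum_eq]
  simp only [sub_zero, inv_one, one_smul]
  have : ∫ x in (0 : ℝ)..1, ‖f' x‖ ^ 2 ≤ ∫ x in (0 : ℝ)..1, B ^ 2 := by
    refine intervalIntegral.integral_mono_on zero_le_one ?_ ?_ ?_
    · exact ((hf'.norm).pow 2).intervalIntegrable _ _
    · exact continuous_const.intervalIntegrable _ _
    · intro x _
      exact pow_le_pow_left₀ (norm_nonneg _) (hB x) 2
  simpa using this

/-- Integration of continuous functions on the circle against a probability measure. -/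
noncomputable def circleIntegralCLM (μ : Measure UnitAddCircle) [IsProbabilityMeasure μ] :
    C(UnitAddCircle, ℂ) →L[ℂ] ℂ :=
  LinearMap.mkContinuous
    { toFun := fun g => ∫ x, g x ∂μ
      map_add' := fun f g => integral_add
        (Integrable.of_bound f.continuous.aestronglyMeasurable ‖f‖
          (Eventually.of_forall fun x => f.norm_coe_le_norm x))
        (Integrable.of_bound g.continuous.aestronglyMeasurable ‖g‖
          (Eventually.of_forall fun x => g.norm_coe_le_norm x))
      map_smul' := fun c f => integral_const_mul c f } 1 (fun f => by
        have := norm_integral_le_of_norm_le_const (μ := μ) (f := f) (C := ‖f‖)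
          (Eventually.of_forall fun x => f.norm_coe_le_norm x)
        simpa using this)

/-- Expand ψ in its Fourier series: the difference is the sum of ψ̂(k) D(k), with ψ̂(k) of size
c'(k)/(2π|k|). Parseval bounds the sum of c'(k)² by B², and |D(k)|²/k² is at most 2τ²|k|^(-3/2),
with total at most 12τ². Cauchy–Schwarz would give √12/(2π) < 0.56. -/
theorem abs_integral_sub_integral_le_of_fourier {ψ : UnitAddCircle → ℝ} {ψ' : ℝ → ℝ} {B τ : ℝ}
    (hψ : ∀ x : ℝ, HasDerivAt (fun x : ℝ => ψ x) (ψ' x) x) (hψc : Continuous ψ)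
    (hψ' : Continuous ψ') (hB0 : 0 < B) (hB : ∀ x, |ψ' x| ≤ B) (hτ : 0 < τ)
    (μ ν : Measure UnitAddCircle) [IsProbabilityMeasure μ] [IsProbabilityMeasure ν]
    (h : ∀ k : ℕ, 1 ≤ k →
      ‖∫ x, fourier (k : ℤ) x ∂μ - ∫ x, fourier (k : ℤ) x ∂ν‖ ^ 2 ≤ 2 * τ ^ 2 * √(k : ℝ)) :
    |∫ x, ψ x ∂μ - ∫ x, ψ x ∂ν| ≤ 0.56 * B * τ := by
  have hpi := Real.pi_pos
  set f : C(UnitAddCircle, ℂ) := ⟨fun x => (ψ x : ℂ), Complex.continuous_ofReal.comp hψc⟩ with hf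
  set f' : ℝ → ℂ := fun x => (ψ' x : ℂ) with hf'
  have hff' : ∀ x : ℝ, HasDerivAt (fun x : ℝ => f x) (f' x) x := fun x => (hψ x).ofReal_comp
  have hf'c : Continuous f' := Complex.continuous_ofReal.comp hψ'
  obtain ⟨hs, hsB⟩ := sum_sq_fourierCoeffOn_le hf'c (B := B) (fun x => by simpa [hf'] using hB x)
  obtain ⟨hu, huB⟩ := summable_int_inv_mul_sqrt
  set c' : ℤ → ℝ := fun k => ‖fourierCoeffOn zero_lt_one f' k‖ with hc'
  set u : ℤ → ℝ := fun k => (|(k : ℝ)| * √|(k : ℝ)|)⁻¹ with hu_def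
  set D : ℤ → ℂ := fun k => ∫ x, fourier k x ∂μ - ∫ x, fourier k x ∂ν with hD
  have hD0 : D 0 = 0 := by simp [hD]
  -- Negative modes are conjugates of positive ones, and the zero mode vanishes for probability
  -- measures, so bounds for k ≥ 1 suffice.
  have hDneg : ∀ k, ‖D (-k)‖ = ‖D k‖ := by
    intro k
    have : D (-k) = (starRingEnd ℂ) (D k) := by
      simp only [hD, map_sub, fourier_neg, ← integral_conj]
    rw [this, RCLike.norm_conj]
  have hDk : ∀ k : ℤ, ‖D k‖ ^ 2 ≤ 2 * τ ^ 2 * √|(k : ℝ)| := by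
    have hnat : ∀ n : ℕ, ‖D n‖ ^ 2 ≤ 2 * τ ^ 2 * √(n : ℝ) := by
      intro n
      rcases Nat.eq_zero_or_pos n with rfl | hn
      · simp [hD0]
      · exact h n hn
    intro k
    rcases k.eq_nat_or_neg with ⟨n, rfl | rfl⟩
    · simpa using hnat n
    · rw [hDneg]
      simpa using hnat n
  have hcoef : ∀ k : ℤ, k ≠ 0 → ‖fourierCoeff f k‖ = c' k / (2 * Real.pi * |(k : ℝ)|) :=
    fun k hk => fourierCoeff_eq_of_hasDerivAt hff' hf'c hk
  have hk1 : ∀ k : ℤ, k ≠ 0 → 1 ≤ |(k : ℝ)| := fun k hk => by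
    have := Int.one_le_abs hk
    exact_mod_cast this
  have hterm : ∀ k : ℤ, ‖fourierCoeff f k * D k‖ ≤
      (2 * Real.pi)⁻¹ * (7 * τ / (4 * B) * c' k ^ 2 + 2 * B * τ / 7 * u k) := by
    intro k
    rcases eq_or_ne k 0 with rfl | hk
    · rw [hD0, mul_zero, norm_zero]
      positivity
    · have hk1 := hk1 k hk
      have hk0 : 0 < |(k : ℝ)| := by linarith
      rw [norm_mul, hcoef k hk]
      have hDb : (‖D k‖ / |(k : ℝ)|) ^ 2 ≤ 2 * τ ^ 2 * u k := by
        rw [div_pow, div_le_iff₀ (by positivity)]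
        refine (hDk k).trans (le_of_eq ?_)
        simp only [hu_def]
        have hsq : √|(k : ℝ)| * √|(k : ℝ)| = |(k : ℝ)| := Real.mul_self_sqrt hk0.le
        have hsq0 : 0 < √|(k : ℝ)| := Real.sqrt_pos.2 hk0
        field_simp
        nlinarith
      -- Weighted AM-GM in place of Cauchy–Schwarz; the optimal weight √3 τ/B is rounded to 7τ/(4B),
      -- which yields 97/28 instead of √12.
      have hamgm : c' k * (‖D k‖ / |(k : ℝ)|) ≤
          7 * τ / (4 * B) * c' k ^ 2 + B / (7 * τ) * (‖D k‖ / |(k : ℝ)|) ^ 2 := by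
        have := sq_nonneg (7 * τ * c' k - 2 * B * (‖D k‖ / |(k : ℝ)|))
        rw [← sub_nonneg]
        have e : 7 * τ / (4 * B) * c' k ^ 2 + B / (7 * τ) * (‖D k‖ / |(k : ℝ)|) ^ 2
            - c' k * (‖D k‖ / |(k : ℝ)|) =
            (7 * τ * c' k - 2 * B * (‖D k‖ / |(k : ℝ)|)) ^ 2 / (28 * τ * B) := by
          field_simp
          ring
        rw [e]
        positivity
      calc c' k / (2 * Real.pi * |(k : ℝ)|) * ‖D k‖
          = (2 * Real.pi)⁻¹ * (c' k * (‖D k‖ / |(k : ℝ)|)) := by field_simp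
        _ ≤ (2 * Real.pi)⁻¹ * (7 * τ / (4 * B) * c' k ^ 2 + B / (7 * τ) * (2 * τ ^ 2 * u k)) := by
            gcongr
            exact hamgm.trans (by gcongr)
        _ = _ := by
            congr 2
            field_simp
  -- Absolute summability makes the Fourier series converge uniformly to f, so the two integrals can
  -- be applied termwise.
  have hsummable : Summable (fourierCoeff f) := by
    refine Summable.of_norm_bounded_eventually (hs.add hu) ?_
    filter_upwards [(Set.finite_singleton (0 : ℤ)).compl_mem_cofinite] with k hk
    have hk0 : k ≠ 0 := hk
    have h1 := hk1 k hk0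
    have hpos : 0 < |(k : ℝ)| := by linarith
    rw [hcoef k hk0]
    have e1 : c' k / (2 * Real.pi * |(k : ℝ)|) ≤ c' k * |(k : ℝ)|⁻¹ := by
      rw [← div_eq_mul_inv]
      refine div_le_div_of_nonneg_left (norm_nonneg _) hpos ?_
      nlinarith [Real.pi_gt_three]
    have e2 : (|(k : ℝ)|⁻¹) ^ 2 ≤ u k := by
      rw [inv_pow]
      refine inv_anti₀ (by positivity) ?_
      rw [sq]
      gcongr
      rw [Real.sqrt_le_left hpos.le]
      nlinarith
    have e3 := sq_nonneg (c' k - |(k : ℝ)|⁻¹)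
    change _ ≤ c' k ^ 2 + u k
    nlinarith [sq_nonneg (c' k), sq_nonneg (|(k : ℝ)|⁻¹)]
  have hsum := hasSum_fourier_series_of_summable hsummable
  have hℓ := ((circleIntegralCLM μ - circleIntegralCLM ν).hasSum hsum)
  have hval : (circleIntegralCLM μ - circleIntegralCLM ν) f
      = ((∫ x, ψ x ∂μ - ∫ x, ψ x ∂ν : ℝ) : ℂ) := by
    change ∫ x, (ψ x : ℂ) ∂μ - ∫ x, (ψ x : ℂ) ∂ν = _
    rw [integral_complex_ofReal, integral_complex_ofReal]
    push_cast
    rfl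
  have hcoe : ∀ k, (circleIntegralCLM μ - circleIntegralCLM ν) (fourierCoeff f k • fourier k)
      = fourierCoeff f k * D k := by
    intro k
    rw [map_smul]
    rfl
  rw [hval] at hℓ
  have hmaj : HasSum (fun k => (2 * Real.pi)⁻¹ * (7 * τ / (4 * B) * c' k ^ 2 + 2 * B * τ / 7 * u k))
      ((2 * Real.pi)⁻¹ * (7 * τ / (4 * B) * (∑' k, c' k ^ 2) + 2 * B * τ / 7 * ∑' k, u k)) :=
    ((hs.hasSum.mul_left _).add (hu.hasSum.mul_left _)).mul_left _
  have hfinal := tsum_of_norm_bounded hmaj (f := fun k => fourierCoeff f k * D k) hterm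
  have heq : ∑' k, fourierCoeff f k * D k = ((∫ x, ψ x ∂μ - ∫ x, ψ x ∂ν : ℝ) : ℂ) := by
    rw [← hℓ.tsum_eq]
    exact tsum_congr fun k => (hcoe k).symm
  rw [heq, Complex.norm_real, Real.norm_eq_abs] at hfinal
  refine hfinal.trans ?_
  have h1 : 7 * τ / (4 * B) * (∑' k, c' k ^ 2) + 2 * B * τ / 7 * ∑' k, u k ≤
      7 * τ / (4 * B) * B ^ 2 + 2 * B * τ / 7 * 6 := by gcongr
  have h2 : 7 * τ / (4 * B) * B ^ 2 + 2 * B * τ / 7 * 6 = (97 / 28) * (B * τ) := by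
    field_simp
    norm_num
  rw [h2] at h1
  rw [inv_mul_le_iff₀ (by positivity)]
  refine h1.trans ?_
  have := mul_le_mul_of_nonneg_right (Real.pi_gt_d2.le) (mul_pos hB0 hτ).le
  nlinarith

/-! ### Evaluating a random map at an independent random point -/

theorem map_eq_map_prod_of_indepFun {Ω Ω' M : Type*} [MeasurableSpace Ω] [MeasurableSpace Ω']
    [MeasurableSpace M] {P : Measure Ω} [IsProbabilityMeasure P] {X : Ω → Ω'} {Y : Ω → M}
    (hX : Measurable X) (hY : Measurable Y) (hind : IndepFun X Y P) {F : Ω' → M → M}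
    (hF : Measurable (fun p : Ω' × M => F p.1 p.2)) :
    P.map (fun ω => F (X ω) (Y ω)) =
      (P.prod (P.map Y)).map (fun p : Ω × M => F (X p.1) p.2) := by
  have h1 := (indepFun_iff_map_prod_eq_prod_map_map hX.aemeasurable hY.aemeasurable).1 hind
  have : IsProbabilityMeasure (P.map Y) := Measure.isProbabilityMeasure_map hY.aemeasurable
  have h2 := Measure.map_prod_map P (P.map Y) hX (measurable_id (α := M))
  rw [Measure.map_id, ← h1] at h2
  have h3 := congrArg (Measure.map fun p : Ω' × M => F p.1 p.2) h2
  rw [Measure.map_map hF (hX.prodMk hY), Measure.map_map hF (hX.prodMap measurable_id)] at h3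
  exact h3

/-- The identity from Ω to Ω with the smaller σ-algebra m₁ serves as the random variable carrying f;
it is independent of u. -/
theorem map_prod_of_indep {Ω M : Type*} {m₁ m₂ : MeasurableSpace Ω} [mΩ : MeasurableSpace Ω]
    [MeasurableSpace M] {P : Measure Ω} [IsProbabilityMeasure P] (h₁ : m₁ ≤ mΩ) (h₂ : m₂ ≤ mΩ)
    (hind : Indep m₁ m₂ P) {f : Ω → M → M} {u : Ω → M}
    (hf : Measurable[m₁.prod inferInstance] (fun p : Ω × M => f p.1 p.2)) (hu : Measurable[m₂] u) :
    P.map (fun ω => f ω (u ω)) = (P.prod (P.map u)).map (fun p : Ω × M => f p.1 p.2) := by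
  have hu' : Measurable u := hu.mono h₂ le_rfl
  have hid : @Measurable Ω Ω mΩ m₁ id := fun s hs => h₁ s hs
  have hindep : @IndepFun Ω Ω M mΩ m₁ _ id u P := by
    refine (@IndepFun_iff_Indep Ω Ω M mΩ m₁ _ id u P).2 ?_
    rw [MeasurableSpace.comap_id]
    exact indep_of_indep_of_le_right hind hu.comap_le
  exact @map_eq_map_prod_of_indepFun Ω Ω M mΩ m₁ _ P _ id u hid hu' hindep f hf

/-! ### The σ-algebras of the node maps -/

section NodeSigma

variable {Ω ι : Type*} {θ : Ω → Ω} {φ : ι → ℕ → Ω → UnitAddCircle → UnitAddCircle} {lam : ℝ}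

/-- The σ-algebra generated by the maps of the nodes `p.2` at the times `p.1`, for `p ∈ S`. -/
def nodeSigma (θ : Ω → Ω) (φ : ι → ℕ → Ω → UnitAddCircle → UnitAddCircle) (S : Set (ℕ × ι)) :
    MeasurableSpace Ω :=
  ⨆ p ∈ S, MeasurableSpace.comap
    (fun (ω : Ω) (x : UnitAddCircle) => φ p.2 1 (θ^[p.1] ω) x) inferInstance

theorem measurable_nodeSigma_eval {S : Set (ℕ × ι)} {p : ℕ × ι} (hp : p ∈ S) (x : UnitAddCircle) :
    Measurable[nodeSigma θ φ S] (fun ω => φ p.2 1 (θ^[p.1] ω) x) := by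
  have h : Measurable[nodeSigma θ φ S]
      (fun (ω : Ω) (x : UnitAddCircle) => φ p.2 1 (θ^[p.1] ω) x) :=
    measurable_iff_comap_le.2 (le_biSup (fun p : ℕ × ι => MeasurableSpace.comap
      (fun (ω : Ω) (x : UnitAddCircle) => φ p.2 1 (θ^[p.1] ω) x) inferInstance) hp)
  exact (measurable_pi_apply x).comp h

theorem continuous_of_dist_le {f : UnitAddCircle → UnitAddCircle}
    (h : ∀ x y, dist (f x) (f y) ≤ lam * dist x y) : Continuous f :=
  (LipschitzWith.of_dist_le' h).continuous

/-- Evaluations generate the σ-algebra, and continuity in x upgrades measurability in ω to joint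
measurability. This is needed for the small σ-algebra, on which independence is available. -/
theorem measurable_nodeSigma_uncurry (hcontr : ∀ i ω x y, dist (φ i 1 ω x) (φ i 1 ω y) ≤ lam * dist x y)
    {S : Set (ℕ × ι)} {p : ℕ × ι} (hp : p ∈ S) : Measurable[(nodeSigma θ φ S).prod inferInstance]
      (fun q : Ω × UnitAddCircle => φ p.2 1 (θ^[p.1] q.1) q.2) := by
  let _ : MeasurableSpace Ω := nodeSigma θ φ S
  have := measurable_uncurry_of_continuous_of_measurable (u := fun x ω => φ p.2 1 (θ^[p.1] ω) x)
    (fun ω => continuous_of_dist_le (hcontr p.2 _)) (measurable_nodeSigma_eval hp)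
  exact this.comp measurable_swap

theorem measurable_node_comp (hcontr : ∀ i ω x y, dist (φ i 1 ω x) (φ i 1 ω y) ≤ lam * dist x y)
    {S : Set (ℕ × ι)} {p : ℕ × ι} (hp : p ∈ S) {u : Ω → UnitAddCircle}
    (hu : Measurable[nodeSigma θ φ S] u) :
    Measurable[nodeSigma θ φ S] (fun ω => φ p.2 1 (θ^[p.1] ω) (u ω)) := by
  let _ : MeasurableSpace Ω := nodeSigma θ φ S
  exact (measurable_nodeSigma_uncurry hcontr hp).comp (measurable_id.prodMk hu)

theorem measurable_forward {i : ι} (hzero : ∀ ω x, φ i 0 ω x = x)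
    (hsucc : ∀ n ω x, φ i (n + 1) ω x = φ i 1 (θ^[n] ω) (φ i n ω x))
    (hcontr : ∀ i ω x y, dist (φ i 1 ω x) (φ i 1 ω y) ≤ lam * dist x y) (s n : ℕ)
    (x : UnitAddCircle) {S : Set (ℕ × ι)} (hS : ∀ k < n, (s + k, i) ∈ S) :
    Measurable[nodeSigma θ φ S] (fun ω => φ i n (θ^[s] ω) x) := by
  induction n with
  | zero =>
    simp only [hzero]
    exact measurable_const
  | succ n ih =>
    have := measurable_node_comp hcontr (hS n n.lt_succ_self)
      (ih fun k hk => hS k (hk.trans n.lt_succ_self))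
    convert this using 2 with ω
    rw [hsucc, ← Function.iterate_add_apply, add_comm n s]

theorem measurable_backwardIterate (hcontr : ∀ i ω x y, dist (φ i 1 ω x) (φ i 1 ω y) ≤ lam * dist x y)
    (i : ι) (s n : ℕ) (x : UnitAddCircle) {S : Set (ℕ × ι)} (hS : ∀ k, (s + k, i) ∈ S) :
    Measurable[nodeSigma θ φ S] (fun ω => backwardIterate θ (φ i) x n (θ^[s] ω)) := by
  induction n generalizing s with
  | zero => exact measurable_const
  | succ n ih =>
    have h1 := ih (s + 1) (fun k => by rw [add_assoc, add_comm 1 k]; exact hS (k + 1))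
    have := measurable_node_comp hcontr (hS 0) h1
    convert this using 2 with ω
    simp only [backwardIterate, Function.iterate_succ', Function.comp, add_zero]

/-! ### Contraction along the backward iterates -/

theorem tendsto_codingMap (hlam : lam ∈ Set.Ioo (0 : ℝ) 1)
    (hcontr : ∀ i ω x y, dist (φ i 1 ω x) (φ i 1 ω y) ≤ lam * dist x y) (i : ι) (ω : Ω) :
    Tendsto (fun n => backwardIterate θ (φ i) 0 n ω) atTop (nhds (codingMap θ (φ i) ω)) := by
  have hd : ∀ n ω, dist (backwardIterate θ (φ i) 0 n ω) (backwardIterate θ (φ i) 0 (n + 1) ω) ≤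
      1 / 2 * lam ^ n := by
    intro n
    induction n with
    | zero => intro ω; simpa using UnitAddCircle.dist_le_half _ _
    | succ n ih =>
      intro ω
      refine (hcontr i ω _ _).trans ?_
      rw [pow_succ]
      have := mul_le_mul_of_nonneg_left (ih (θ ω)) hlam.1.le
      linarith
  exact (cauchySeq_of_le_geometric lam (1 / 2) hlam.2 (fun n => hd n ω)).tendsto_limUnder

theorem codingMap_eq (hlam : lam ∈ Set.Ioo (0 : ℝ) 1)
    (hcontr : ∀ i ω x y, dist (φ i 1 ω x) (φ i 1 ω y) ≤ lam * dist x y) (i : ι) (ω : Ω) :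
    codingMap θ (φ i) ω = φ i 1 ω (codingMap θ (φ i) (θ ω)) := by
  have h1 := (tendsto_codingMap (θ := θ) hlam hcontr i ω).comp (tendsto_add_atTop_nat 1)
  have h2 := ((continuous_of_dist_le (hcontr i ω)).tendsto _).comp
    (tendsto_codingMap (θ := θ) hlam hcontr i (θ ω))
  exact tendsto_nhds_unique h1 h2

theorem measurable_codingMap (hlam : lam ∈ Set.Ioo (0 : ℝ) 1)
    (hcontr : ∀ i ω x y, dist (φ i 1 ω x) (φ i 1 ω y) ≤ lam * dist x y) (i : ι) (s : ℕ)
    {S : Set (ℕ × ι)} (hS : ∀ k, (s + k, i) ∈ S) :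
    Measurable[nodeSigma θ φ S] (fun ω => codingMap θ (φ i) (θ^[s] ω)) := by
  let _ : MeasurableSpace Ω := nodeSigma θ φ S
  refine measurable_of_tendsto_metrizable
    (fun n => measurable_backwardIterate hcontr i s n 0 hS) ?_
  rw [tendsto_pi_nhds]
  exact fun ω => tendsto_codingMap hlam hcontr i (θ^[s] ω)

end NodeSigma

section NodeMaps

variable {Ω ι : Type*} [MeasurableSpace Ω] {P : Measure Ω} {θ : Ω → Ω}
  {φ : ι → ℕ → Ω → UnitAddCircle → UnitAddCircle} {lam : ℝ}

theorem comap_node_le (hθ : Measurable θ) (hrds : ∀ i, IsRDS θ (φ i)) (p : ℕ × ι) :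
    MeasurableSpace.comap (fun (ω : Ω) (x : UnitAddCircle) => φ p.2 1 (θ^[p.1] ω) x) inferInstance
      ≤ ‹MeasurableSpace Ω› := by
  refine Measurable.comap_le (measurable_pi_iff.2 fun x => ?_)
  exact ((hrds p.2).measurable 1).comp ((hθ.iterate p.1).prodMk measurable_const)

theorem nodeSigma_le (hθ : Measurable θ) (hrds : ∀ i, IsRDS θ (φ i)) (S : Set (ℕ × ι)) :
    nodeSigma θ φ S ≤ ‹MeasurableSpace Ω› :=
  iSup₂_le fun p _ => comap_node_le hθ hrds p

theorem indep_nodeSigma (hθ : Measurable θ) (hrds : ∀ i, IsRDS θ (φ i))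
    (hnodes : IIDNodeMaps P θ φ) {S T : Set (ℕ × ι)} (hST : Disjoint S T) :
    Indep (nodeSigma θ φ S) (nodeSigma θ φ T) P :=
  indep_iSup_of_disjoint (comap_node_le hθ hrds) hnodes.indep hST

theorem IsRDS.succ {M : Type*} [MeasurableSpace M] {ψ : ℕ → Ω → M → M} (h : IsRDS θ ψ) (n : ℕ) (ω : Ω) (x : M) :
    ψ (n + 1) ω x = ψ 1 (θ^[n] ω) (ψ n ω x) := by
  rw [add_comm, h.add]

/-! ### Stationary measures of the node chains -/

theorem IIDNodeMaps.measure_preimage_eq (hnodes : IIDNodeMaps P θ φ) (i j : ι) (x : UnitAddCircle)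
    {B : Set UnitAddCircle} (hB : MeasurableSet B) :
    P {ω | φ i 1 ω x ∈ B} = P {ω | φ j 1 ω x ∈ B} := by
  have := ((hnodes.ident (0, i) (0, j)).comp (measurable_pi_apply x)).measure_mem_eq hB
  exact this

theorem map_uncurry_apply [SFinite P] {ψ : Ω → UnitAddCircle → UnitAddCircle}
    (hψ : Measurable (fun p : Ω × UnitAddCircle => ψ p.1 p.2)) (m : Measure UnitAddCircle) [SFinite m]
    {B : Set UnitAddCircle} (hB : MeasurableSet B) :
    ((P.prod m).map (fun p : Ω × UnitAddCircle => ψ p.1 p.2)) B =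
      ∫⁻ x, P {ω | ψ ω x ∈ B} ∂m := by
  rw [Measure.map_apply hψ hB, Measure.prod_apply_symm (hψ hB)]
  rfl

theorem IsStationaryMeasure.map_eq [SFinite P] {ψ : ℕ → Ω → UnitAddCircle → UnitAddCircle}
    (hψ : IsRDS θ ψ) {m : Measure UnitAddCircle} (hm : IsStationaryMeasure P ψ m) :
    (P.prod m).map (fun p : Ω × UnitAddCircle => ψ 1 p.1 p.2) = m := by
  have := hm.isProb
  ext B hB
  rw [map_uncurry_apply (hψ.measurable 1) m hB, hm.stationary B hB]

/-- In π(ω) = φ(1, ω, π(θω)) the inner point depends only on times ≥ 1 and has the law of π, since θ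
preserves P; it is independent of the outer map. The common law of the node maps then carries
stationarity from node j to node i. -/
theorem isStationaryMeasure_codingMeasure [IsProbabilityMeasure P] (hθ : MeasurePreserving θ P P)
    (hlam : lam ∈ Set.Ioo (0 : ℝ) 1) (hrds : ∀ i, IsRDS θ (φ i))
    (hcontr : ∀ i ω x y, dist (φ i 1 ω x) (φ i 1 ω y) ≤ lam * dist x y)
    (hnodes : IIDNodeMaps P θ φ) (i j : ι) :
    IsStationaryMeasure P (φ i) (codingMeasure P θ (φ j)) := by
  have hle := nodeSigma_le hθ.measurable hrds
  have hmeas : Measurable (codingMap θ (φ j)) :=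
    (measurable_codingMap hlam hcontr j 0 (fun k => Set.mem_univ _)).mono (hle _) le_rfl
  have hu : Measurable[nodeSigma θ φ {q | 1 ≤ q.1}] (fun ω => codingMap θ (φ j) (θ ω)) :=
    measurable_codingMap hlam hcontr j 1 (fun k => by simp)
  have hind := indep_nodeSigma hθ.measurable hrds hnodes (S := {(0, j)}) (T := {q | 1 ≤ q.1})
    (by simp)
  have hprob : IsProbabilityMeasure (codingMeasure P θ (φ j)) :=
    Measure.isProbabilityMeasure_map hmeas.aemeasurable
  refine ⟨hprob, fun B hB => ?_⟩
  have h2 : P.map (fun ω => codingMap θ (φ j) (θ ω)) = codingMeasure P θ (φ j) := by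
    have := Measure.map_map (μ := P) hmeas hθ.measurable
    rw [hθ.map_eq] at this
    exact this.symm
  have h3 := map_prod_of_indep (hle _) (hle _) hind
    (measurable_nodeSigma_uncurry hcontr (Set.mem_singleton (0, j))) hu
  simp only [← codingMap_eq hlam hcontr] at h3
  rw [h2] at h3
  calc ∫⁻ x, P {ω | φ i 1 ω x ∈ B} ∂codingMeasure P θ (φ j)
      = ∫⁻ x, P {ω | φ j 1 ω x ∈ B} ∂codingMeasure P θ (φ j) :=
        lintegral_congr fun x => hnodes.measure_preimage_eq i j x hB
    _ = ((P.prod (codingMeasure P θ (φ j))).map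
          (fun p : Ω × UnitAddCircle => φ j 1 p.1 p.2)) B :=
        (map_uncurry_apply ((hrds j).measurable 1) _ hB).symm
    _ = codingMeasure P θ (φ j) B := by rw [← h3]; rfl

/-! ### Exponential forgetting and uniqueness of the stationary measure -/

theorem continuous_of_abs_sub_le {g : UnitAddCircle → ℝ} {B : ℝ}
    (hg : ∀ p q, |g p - g q| ≤ B * dist p q) : Continuous g :=
  (LipschitzWith.of_dist_le' (K := B) hg).continuous

theorem integrable_of_abs_sub_le {α : Type*} [MeasurableSpace α] {μ : Measure α} [IsFiniteMeasure μ]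
    {g : UnitAddCircle → ℝ} {B : ℝ} (hB : 0 ≤ B) (hg : ∀ p q, |g p - g q| ≤ B * dist p q)
    {u : α → UnitAddCircle} (hu : Measurable u) : Integrable (fun a => g (u a)) μ := by
  refine Integrable.of_bound ((continuous_of_abs_sub_le hg).measurable.comp hu).aestronglyMeasurable
    (|g 0| + B / 2) (Eventually.of_forall fun a => ?_)
  have h1 := (hg (u a) 0).trans (mul_le_mul_of_nonneg_left (UnitAddCircle.dist_le_half _ _) hB)
  have h2 := abs_sub_abs_le_abs_sub (g (u a)) (g 0)
  rw [Real.norm_eq_abs]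
  linarith

/-- The Markov property: the map at time n is independent of the first n steps, and invariance of P
under θ^n replaces it by the map at time 0. -/
theorem integral_node_succ [IsProbabilityMeasure P] (hθ : MeasurePreserving θ P P)
    (hrds : ∀ i, IsRDS θ (φ i))
    (hcontr : ∀ i ω x y, dist (φ i 1 ω x) (φ i 1 ω y) ≤ lam * dist x y)
    (hnodes : IIDNodeMaps P θ φ) (i : ι) (n : ℕ) (x : UnitAddCircle)
    {g : UnitAddCircle → ℝ} {B : ℝ} (hB : 0 ≤ B) (hg : ∀ p q, |g p - g q| ≤ B * dist p q) :
    ∫ ω, g (φ i (n + 1) ω x) ∂P = ∫ ω, (∫ ω', g (φ i 1 ω' (φ i n ω x)) ∂P) ∂P := by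
  have hle := nodeSigma_le hθ.measurable hrds
  have hu : Measurable[nodeSigma θ φ {q | q.1 < n}] (fun ω => φ i n ω x) :=
    measurable_forward (hrds i).zero (hrds i).succ hcontr 0 n x (fun k hk => by simpa using hk)
  have hu' : Measurable (fun ω => φ i n ω x) := hu.mono (hle _) le_rfl
  have hind := indep_nodeSigma hθ.measurable hrds hnodes (S := {(n, i)}) (T := {q | q.1 < n})
    (by simp)
  have h3 := map_prod_of_indep (hle _) (hle _) hind (f := fun ω x => φ i 1 (θ^[n] ω) x)
    (measurable_nodeSigma_uncurry hcontr (Set.mem_singleton (n, i))) hu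
  simp only [← (hrds i).succ] at h3
  have hF : Measurable (fun p : Ω × UnitAddCircle => φ i 1 (θ^[n] p.1) p.2) :=
    ((hrds i).measurable 1).comp
      (((hθ.measurable.iterate n).comp measurable_fst).prodMk measurable_snd)
  have hgc := (continuous_of_abs_sub_le hg)
  have : IsProbabilityMeasure (P.map fun ω => φ i n ω x) :=
    Measure.isProbabilityMeasure_map hu'.aemeasurable
  have hsucc : Measurable (fun ω => φ i (n + 1) ω x) :=
    ((hrds i).measurable (n + 1)).comp (measurable_id.prodMk measurable_const)
  have hF1 := integrable_of_abs_sub_le hB hg hF (μ := P.prod (P.map fun ω => φ i n ω x))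
  calc ∫ ω, g (φ i (n + 1) ω x) ∂P = ∫ y, g y ∂(P.map fun ω => φ i (n + 1) ω x) :=
        (integral_map hsucc.aemeasurable hgc.aestronglyMeasurable).symm
    _ = ∫ p, g (φ i 1 (θ^[n] p.1) p.2) ∂(P.prod (P.map fun ω => φ i n ω x)) := by
        rw [h3, integral_map hF.aemeasurable hgc.aestronglyMeasurable]
    _ = ∫ y, (∫ ω', g (φ i 1 (θ^[n] ω') y) ∂P) ∂(P.map fun ω => φ i n ω x) :=
        integral_prod_symm _ hF1
    _ = ∫ y, (∫ ω', g (φ i 1 ω' y) ∂P) ∂(P.map fun ω => φ i n ω x) := by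
        refine integral_congr_ae (Eventually.of_forall fun y => ?_)
        have hm : Measurable fun ω' => g (φ i 1 ω' y) :=
          hgc.measurable.comp (((hrds i).measurable 1).comp (measurable_id.prodMk measurable_const))
        have := integral_map (μ := P) (hθ.iterate n).measurable.aemeasurable
          (f := fun ω' => g (φ i 1 ω' y)) hm.aestronglyMeasurable
        rw [(hθ.iterate n).map_eq] at this
        exact this.symm
    _ = _ := by
        refine integral_map hu'.aemeasurable ?_
        refine StronglyMeasurable.aestronglyMeasurable ?_
        exact StronglyMeasurable.integral_prod_left (f := fun ω' y => g (φ i 1 ω' y))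
          (hgc.measurable.comp ((hrds i).measurable 1)).stronglyMeasurable

theorem abs_integral_comp_sub_le [IsProbabilityMeasure P] {ψ : ℕ → Ω → UnitAddCircle → UnitAddCircle}
    (hψ : IsRDS θ ψ) (hcontr : ∀ ω x y, dist (ψ 1 ω x) (ψ 1 ω y) ≤ lam * dist x y)
    {g : UnitAddCircle → ℝ} {B : ℝ} (hB : 0 ≤ B) (hg : ∀ p q, |g p - g q| ≤ B * dist p q)
    (x y : UnitAddCircle) :
    |∫ ω, g (ψ 1 ω x) ∂P - ∫ ω, g (ψ 1 ω y) ∂P| ≤ B * lam * dist x y := by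
  have hi := fun x => integrable_of_abs_sub_le hB hg (μ := P)
    ((hψ.measurable 1).comp (measurable_id.prodMk (measurable_const (a := x))))
  have h1 := hi x
  have h2 := hi y
  simp only [Function.comp, id] at h1 h2
  rw [← integral_sub h1 h2]
  have := norm_integral_le_of_norm_le_const (μ := P) (f := fun ω => g (ψ 1 ω x) - g (ψ 1 ω y))
    (C := B * lam * dist x y) (Eventually.of_forall fun ω => by
      rw [Real.norm_eq_abs, mul_assoc]
      exact (hg _ _).trans (mul_le_mul_of_nonneg_left (hcontr ω x y) hB))
  simpa using this

/-- One step of the Markov operator multiplies the Lipschitz constant of g by λ and leaves ∫ g dm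
unchanged, so the induction runs over g. The initial error is B/2 because the circle has diameter
1/2. -/
theorem abs_integral_forward_sub_le [IsProbabilityMeasure P] (hθ : MeasurePreserving θ P P)
    (hlam : lam ∈ Set.Ioo (0 : ℝ) 1) (hrds : ∀ i, IsRDS θ (φ i))
    (hcontr : ∀ i ω x y, dist (φ i 1 ω x) (φ i 1 ω y) ≤ lam * dist x y)
    (hnodes : IIDNodeMaps P θ φ) (i : ι) {m : Measure UnitAddCircle}
    (hm : IsStationaryMeasure P (φ i) m) (x : UnitAddCircle) (n : ℕ)
    {g : UnitAddCircle → ℝ} {B : ℝ} (hB : 0 ≤ B) (hg : ∀ p q, |g p - g q| ≤ B * dist p q) :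
    |∫ ω, g (φ i n ω x) ∂P - ∫ y, g y ∂m| ≤ B * lam ^ n / 2 := by
  have := hm.isProb
  induction n generalizing g B with
  | zero =>
    simp only [(hrds i).zero, integral_const, probReal_univ, one_smul, pow_zero, mul_one]
    have h1 : g x - ∫ y, g y ∂m = ∫ y, (g x - g y) ∂m := by
      rw [integral_sub (integrable_const _) (integrable_of_abs_sub_le hB hg (u := fun y => y) measurable_id)]
      simp
    rw [h1]
    have := norm_integral_le_of_norm_le_const (μ := m) (f := fun y => g x - g y)
      (C := B / 2) (Eventually.of_forall fun y => by
        rw [Real.norm_eq_abs]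
        refine (hg _ _).trans ?_
        have := mul_le_mul_of_nonneg_left (UnitAddCircle.dist_le_half x y) hB
        linarith)
    simpa using this
  | succ n ih =>
    have hg' := abs_integral_comp_sub_le (P := P) (hrds i) (hcontr i) hB hg
    have h1 := ih (mul_nonneg hB hlam.1.le) hg'
    rw [integral_node_succ hθ hrds hcontr hnodes i n x hB hg]
    have h2 : ∫ y, g y ∂m = ∫ y, (∫ ω', g (φ i 1 ω' y) ∂P) ∂m := by
      conv_lhs => rw [← hm.map_eq (hrds i)]
      rw [integral_map ((hrds i).measurable 1).aemeasurable
        (continuous_of_abs_sub_le hg).aestronglyMeasurable]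
      exact integral_prod_symm _
        (integrable_of_abs_sub_le hB hg ((hrds i).measurable 1) (μ := P.prod m))
    rw [h2]
    refine h1.trans (le_of_eq ?_)
    rw [pow_succ]
    ring

/-- Lipschitz observables detect weak convergence; applied to a constant sequence, uniqueness of
weak limits gives equality. -/
theorem eq_of_forall_integral_lipschitz_eq {m m' : Measure UnitAddCircle} [IsProbabilityMeasure m]
    [IsProbabilityMeasure m']
    (h : ∀ (g : UnitAddCircle → ℝ) (B : ℝ), 0 ≤ B → (∀ p q, |g p - g q| ≤ B * dist p q) →
      ∫ y, g y ∂m = ∫ y, g y ∂m') : m = m' := by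
  let μ : ProbabilityMeasure UnitAddCircle := ⟨m, inferInstance⟩
  let μ' : ProbabilityMeasure UnitAddCircle := ⟨m', inferInstance⟩
  have key : Tendsto (fun _ : ℕ => μ) atTop (nhds μ') := by
    refine tendsto_iff_forall_lipschitz_integral_tendsto.2 fun f _ ⟨K, hK⟩ => ?_
    have := h f K K.2 fun p q => by simpa [Real.dist_eq] using hK.dist_le_mul p q
    change Tendsto (fun _ : ℕ => ∫ y, f y ∂m) atTop (nhds (∫ y, f y ∂m'))
    rw [this]
    exact tendsto_const_nhds
  have heq : μ = μ' := tendsto_nhds_unique tendsto_const_nhds key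
  exact congrArg (fun ν : ProbabilityMeasure UnitAddCircle => (ν : Measure UnitAddCircle)) heq

theorem IsStationaryMeasure.unique [IsProbabilityMeasure P] (hθ : MeasurePreserving θ P P)
    (hlam : lam ∈ Set.Ioo (0 : ℝ) 1) (hrds : ∀ i, IsRDS θ (φ i))
    (hcontr : ∀ i ω x y, dist (φ i 1 ω x) (φ i 1 ω y) ≤ lam * dist x y)
    (hnodes : IIDNodeMaps P θ φ) (i : ι) {m m' : Measure UnitAddCircle}
    (hm : IsStationaryMeasure P (φ i) m) (hm' : IsStationaryMeasure P (φ i) m') : m = m' := by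
  have := hm.isProb
  have := hm'.isProb
  refine eq_of_forall_integral_lipschitz_eq fun g B hB hg => ?_
  have hlim : Tendsto (fun n : ℕ => B * lam ^ n / 2) atTop (nhds 0) := by
    have := ((tendsto_pow_atTop_nhds_zero_of_lt_one hlam.1.le hlam.2).const_mul B).div_const 2
    simpa using this
  have key : ∀ {m : Measure UnitAddCircle}, IsStationaryMeasure P (φ i) m →
      Tendsto (fun n : ℕ => ∫ ω, g (φ i n ω 0) ∂P) atTop (nhds (∫ y, g y ∂m)) := by
    intro m hm
    rw [tendsto_iff_dist_tendsto_zero]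
    refine squeeze_zero (fun _ => dist_nonneg) (fun n => ?_) hlim
    exact abs_integral_forward_sub_le hθ hlam hrds hcontr hnodes i hm 0 n hB hg
  exact tendsto_nhds_unique (key hm) (key hm')

end NodeMaps

/-! ### Concentration of empirical Fourier coefficients -/

section Concentration

variable {Ω ι : Type*} [MeasurableSpace Ω] {P : Measure Ω} {θ : Ω → Ω}
  {φ : ι → ℕ → Ω → UnitAddCircle → UnitAddCircle} {lam : ℝ}

theorem iIndepFun_of_measurable_nodeSigma [IsProbabilityMeasure P] (hθ : Measurable θ)
    (hrds : ∀ i, IsRDS θ (φ i)) (hnodes : IIDNodeMaps P θ φ) {β : Type*} [MeasurableSpace β]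
    {w : ι → Ω → β} (hw : ∀ j, Measurable[nodeSigma θ φ {q | q.2 = j}] (w j)) : iIndepFun w P := by
  classical
  rw [iIndepFun_iff_measure_inter_preimage_eq_mul]
  intro S sets hsets
  induction S using Finset.induction_on with
  | empty => simp
  | insert a S ha ih =>
    rw [Finset.set_biInter_insert, Finset.prod_insert ha,
      ← ih fun i hi => hsets i (Finset.mem_insert_of_mem hi)]
    have hind := indep_nodeSigma hθ hrds hnodes (S := {q | q.2 = a}) (T := {q | q.2 ∈ S}) (by
      rw [Set.disjoint_left]
      rintro q (rfl : q.2 = a) hq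
      exact ha hq)
    refine (Indep_iff _ _ P).1 hind _ _ (hw a (hsets a (Finset.mem_insert_self a S))) ?_
    refine @Finset.measurableSet_biInter Ω ι (nodeSigma θ φ {q | q.2 ∈ S}) _ S fun j hj => ?_
    have hle : nodeSigma θ φ {q | q.2 = j} ≤ nodeSigma θ φ {q | q.2 ∈ S} :=
      biSup_mono fun q (hq : q.2 = j) => show q.2 ∈ S from hq ▸ hj
    exact hle _ (hw j (hsets j (Finset.mem_insert_of_mem hj)))

theorem measureReal_average_gt_le [IsProbabilityMeasure P] {L : ℕ} (hL : 1 ≤ L)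
    {X : Fin L → Ω → ℝ} (hX : ∀ j, Measurable (X j)) (hind : iIndepFun X P)
    (hb : ∀ j ω, |X j ω| ≤ 1) {r : ℝ} (hr : 0 ≤ r) :
    P.real {ω | r < |1 / (L : ℝ) * ∑ j, X j ω - 1 / (L : ℝ) * ∑ j, ∫ ω', X j ω' ∂P|} ≤
      2 * Real.exp (-(L * r ^ 2 / 2)) := by
  have hL0 : (0 : ℝ) < L := by exact_mod_cast hL
  have key : ∀ Y : Fin L → Ω → ℝ, (∀ j, Measurable (Y j)) → iIndepFun Y P →
      (∀ j ω, |Y j ω| ≤ 1) →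
      P.real {ω | L * r ≤ ∑ j, (Y j ω - ∫ ω', Y j ω' ∂P)} ≤ Real.exp (-(L * r ^ 2 / 2)) := by
    intro Y hY hYi hYb
    have hs : ∀ j ∈ (Finset.univ : Finset (Fin L)),
        HasSubgaussianMGF (fun ω => Y j ω - ∫ ω', Y j ω' ∂P) ((fun _ => 1) j) P := by
      intro j _
      have := hasSubgaussianMGF_of_mem_Icc (μ := P) (a := -1) (b := 1) (hY j).aemeasurable
        (Eventually.of_forall fun ω => abs_le.1 (hYb j ω))
      -- Values in [-1, 1] give variance proxy ((1 - (-1))/2)² = 1, hence the tail exp(-(Lr)²/(2L)).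
      have e : (‖(1 : ℝ) - -1‖₊ / 2) ^ 2 = 1 := by
        rw [sub_neg_eq_add, one_add_one_eq_two, Real.nnnorm_two, div_self two_ne_zero, one_pow]
      rw [e] at this
      exact this
    have hi : iIndepFun (fun j ω => Y j ω - ∫ ω', Y j ω' ∂P) P :=
      hYi.comp (fun j x => x - ∫ ω', Y j ω' ∂P) (fun j => measurable_id.sub_const _)
    have := HasSubgaussianMGF.measure_sum_ge_le_of_iIndepFun hi hs (mul_nonneg hL0.le hr)
    refine this.trans (le_of_eq ?_)
    congr 1
    simp
    field_simp
  have h1 := key X hX hind hb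
  have h2 := key (fun j ω => -X j ω) (fun j => (hX j).neg)
    (hind.comp (fun _ x => -x) (fun _ => measurable_neg)) (fun j ω => by simpa using hb j ω)
  have hsub : {ω | r < |1 / (L : ℝ) * ∑ j, X j ω - 1 / (L : ℝ) * ∑ j, ∫ ω', X j ω' ∂P|} ⊆
      {ω | L * r ≤ ∑ j, (X j ω - ∫ ω', X j ω' ∂P)} ∪
        {ω | L * r ≤ ∑ j, (-X j ω - ∫ ω', -X j ω' ∂P)} := by
    intro ω hω
    have e : 1 / (L : ℝ) * ∑ j, X j ω - 1 / (L : ℝ) * ∑ j, ∫ ω', X j ω' ∂P =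
        (∑ j, (X j ω - ∫ ω', X j ω' ∂P)) / L := by
      rw [Finset.sum_sub_distrib]
      ring
    simp only [Set.mem_ofPred_eq, e, lt_abs] at hω
    rcases hω with h | h
    · left
      rw [lt_div_iff₀ hL0] at h
      simp only [Set.mem_ofPred_eq]
      linarith
    · right
      rw [← neg_div, lt_div_iff₀ hL0, ← Finset.sum_neg_distrib] at h
      simp only [Set.mem_ofPred_eq, integral_neg]
      refine le_trans (by linarith) (h.le.trans (le_of_eq ?_))
      exact Finset.sum_congr rfl fun j _ => by ring
  calc _ ≤ _ := measureReal_mono hsub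
    _ ≤ _ := measureReal_union_le _ _
    _ ≤ _ := by linarith

/-- The configurations of `L` points on the circle for which some real or imaginary part of a
Fourier coefficient of the empirical measure is far from its reference value. -/
def fourierDeviationSet (L : ℕ) (ν : Measure UnitAddCircle) (τ : ℝ) : Set (Fin L → UnitAddCircle) :=
  ⋃ k : ℕ,
    {u | τ * √√((k : ℝ) + 1) < |1 / (L : ℝ) * ∑ j, (fourier ((k + 1 : ℕ) : ℤ) (u j)).re -
        ∫ x, (fourier ((k + 1 : ℕ) : ℤ) x).re ∂ν|} ∪
    {u | τ * √√((k : ℝ) + 1) < |1 / (L : ℝ) * ∑ j, (fourier ((k + 1 : ℕ) : ℤ) (u j)).im -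
        ∫ x, (fourier ((k + 1 : ℕ) : ℤ) x).im ∂ν|}

theorem measurableSet_fourierDeviationSet (L : ℕ) (ν : Measure UnitAddCircle) (τ : ℝ) :
    MeasurableSet (fourierDeviationSet L ν τ) := by
  refine MeasurableSet.iUnion fun k => MeasurableSet.union ?_ ?_
  · refine measurableSet_lt measurable_const (Continuous.measurable ?_)
    fun_prop
  · refine measurableSet_lt measurable_const (Continuous.measurable ?_)
    fun_prop

/-- The average of finitely many measures. -/
noncomputable def averageMeasure {M : Type*} [MeasurableSpace M] {L : ℕ} (μ : Fin L → Measure M) :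
    Measure M :=
  (L : ENNReal)⁻¹ • ∑ j, μ j

theorem isProbabilityMeasure_averageMeasure {M : Type*} [MeasurableSpace M] {L : ℕ} (hL : 1 ≤ L)
    (μ : Fin L → Measure M) [∀ j, IsProbabilityMeasure (μ j)] :
    IsProbabilityMeasure (averageMeasure μ) := by
  constructor
  simp only [averageMeasure, Measure.smul_apply, Measure.coe_finsetSum, Finset.sum_apply,
    measure_univ, Finset.sum_const, Finset.card_univ, Fintype.card_fin, smul_eq_mul, nsmul_eq_mul,
    mul_one]
  exact ENNReal.inv_mul_cancel (by exact_mod_cast (by omega : L ≠ 0)) (ENNReal.natCast_ne_top L)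

theorem integral_averageMeasure {M E : Type*} [MeasurableSpace M] [NormedAddCommGroup E]
    [NormedSpace ℝ E] {L : ℕ} (μ : Fin L → Measure M) {g : M → E} (hg : ∀ j, Integrable g (μ j)) :
    ∫ x, g x ∂averageMeasure μ = (1 / (L : ℝ)) • ∑ j, ∫ x, g x ∂μ j := by
  rw [averageMeasure, integral_smul_measure, integral_finsetSum_measure fun j _ => hg j]
  simp

/-- The constant in the union bound over all Fourier modes. -/
noncomputable def unionBoundConst : ℝ := ∑' k : ℕ, 4 * Real.exp (-((√((k : ℝ) + 1) - 1) / 2))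

theorem summable_unionBound :
    Summable fun k : ℕ => 4 * Real.exp (-((√((k : ℝ) + 1) - 1) / 2)) := by
  -- With s = √(k + 1), exp(s/2) ≥ (s/2)⁴/4! = s⁴/384, a comparison with 1/(k + 1)².
  have h2 : Summable fun k : ℕ => 4 * Real.exp (1 / 2) * 384 * (1 / ((k : ℝ) + 1) ^ 2) := by
    have := (summable_nat_add_iff 1).2 (Real.summable_one_div_nat_pow.2 one_lt_two)
    exact (by simpa using this : Summable fun k : ℕ => 1 / ((k : ℝ) + 1) ^ 2).mul_left _
  refine Summable.of_nonneg_of_le (fun k => by positivity) (fun k => ?_) h2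
  set s := √((k : ℝ) + 1) with hs
  have hs0 : 0 < s := Real.sqrt_pos.2 (by positivity)
  have hk : ((k : ℝ) + 1) ^ 2 = s ^ 4 := by
    rw [show s ^ 4 = (s ^ 2) ^ 2 by ring, Real.sq_sqrt (by positivity)]
  have h3 := Real.pow_div_factorial_le_exp (s / 2) (by positivity) 4
  have h4 : Real.exp (-((s - 1) / 2)) = Real.exp (1 / 2) * (Real.exp (s / 2))⁻¹ := by
    rw [← Real.exp_neg, ← Real.exp_add]
    congr 1
    ring
  rw [h4, hk, mul_assoc, mul_assoc]
  gcongr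
  rw [mul_one_div, inv_le_comm₀ (Real.exp_pos _) (by positivity)]
  refine le_trans (le_of_eq ?_) h3
  norm_num [Nat.factorial]
  ring

/-- Two-sided Hoeffding for the real and imaginary part of each mode, then a union bound. The
hypothesis `hτL` lets one factor exp(-Lτ²/2) be pulled out of every term with a summable remainder.
-/
theorem measureReal_fourierDeviationSet_le [IsProbabilityMeasure P] {L : ℕ} (hL : 1 ≤ L)
    {w : Fin L → Ω → UnitAddCircle} (hw : ∀ j, Measurable (w j)) (hind : iIndepFun w P) {τ : ℝ}
    (hτ : 0 ≤ τ) (hτL : 1 / 2 ≤ L * τ ^ 2 / 2) :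
    P.real {ω | (fun j => w j ω) ∈ fourierDeviationSet L (averageMeasure fun j => P.map (w j)) τ} ≤
      unionBoundConst * Real.exp (-(L * τ ^ 2 / 2)) := by
  set ν := averageMeasure fun j => P.map (w j) with hν
  have hprob : ∀ j, IsProbabilityMeasure (P.map (w j)) := fun j =>
    Measure.isProbabilityMeasure_map (hw j).aemeasurable
  have hsingle : ∀ (g : UnitAddCircle → ℝ), Continuous g → (∀ x, |g x| ≤ 1) → ∀ r : ℝ, 0 ≤ r →
      P.real {ω | r < |1 / (L : ℝ) * ∑ j, g (w j ω) - ∫ x, g x ∂ν|} ≤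
        2 * Real.exp (-(L * r ^ 2 / 2)) := by
    intro g hg hb r hr
    have h1 : ∫ x, g x ∂ν = 1 / (L : ℝ) * ∑ j, ∫ ω', g (w j ω') ∂P := by
      rw [hν, integral_averageMeasure _ fun j => Integrable.of_bound hg.aestronglyMeasurable 1
        (Eventually.of_forall fun x => by simpa using hb x), smul_eq_mul]
      congr 1
      exact Finset.sum_congr rfl fun j _ =>
        integral_map (hw j).aemeasurable hg.aestronglyMeasurable
    rw [h1]
    exact measureReal_average_gt_le hL (fun j => hg.measurable.comp (hw j))
      (hind.comp (fun _ => g) fun _ => hg.measurable) (fun j ω => hb _) hr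
  have hbound : ∀ k : ℕ, P.real {ω | (fun j => w j ω) ∈
      {u : Fin L → UnitAddCircle | τ * √√((k : ℝ) + 1) < |1 / (L : ℝ) * ∑ j, (fourier ((k + 1 : ℕ) : ℤ) (u j)).re -
          ∫ x, (fourier ((k + 1 : ℕ) : ℤ) x).re ∂ν|} ∪
      {u | τ * √√((k : ℝ) + 1) < |1 / (L : ℝ) * ∑ j, (fourier ((k + 1 : ℕ) : ℤ) (u j)).im -
          ∫ x, (fourier ((k + 1 : ℕ) : ℤ) x).im ∂ν|}} ≤
      4 * Real.exp (-((√((k : ℝ) + 1) - 1) / 2)) * Real.exp (-(L * τ ^ 2 / 2)) := by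
    intro k
    have hn : ∀ x : UnitAddCircle, ‖fourier ((k + 1 : ℕ) : ℤ) x‖ = 1 := fun x => by
      rw [fourier_apply]
      exact Circle.norm_coe _
    have hr : 0 ≤ τ * √√((k : ℝ) + 1) := by positivity
    have h1 := hsingle (fun x => (fourier ((k + 1 : ℕ) : ℤ) x).re) (by fun_prop)
      (fun x => (Complex.abs_re_le_norm _).trans (hn x).le) _ hr
    have h2 := hsingle (fun x => (fourier ((k + 1 : ℕ) : ℤ) x).im) (by fun_prop)
      (fun x => (Complex.abs_im_le_norm _).trans (hn x).le) _ hr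
    -- This is (Lτ²/2 - 1/2)(√(k + 1) - 1) ≥ 0 after taking exponents.
    have h3 : Real.exp (-(L * (τ * √√((k : ℝ) + 1)) ^ 2 / 2)) ≤
        Real.exp (-((√((k : ℝ) + 1) - 1) / 2)) * Real.exp (-(L * τ ^ 2 / 2)) := by
      rw [← Real.exp_add, Real.exp_le_exp, mul_pow, Real.sq_sqrt (Real.sqrt_nonneg _)]
      have hs1 : 1 ≤ √((k : ℝ) + 1) := Real.one_le_sqrt.2 (by linarith [(Nat.cast_nonneg k : (0 : ℝ) ≤ k)])
      nlinarith [mul_nonneg (sub_nonneg.2 hτL) (sub_nonneg.2 hs1)]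
    refine (measureReal_union_le _ _).trans ?_
    change P.real {ω | _} + P.real {ω | _} ≤ _
    linarith
  have hsum := summable_unionBound.mul_right (Real.exp (-(L * τ ^ 2 / 2)))
  rw [measureReal_def]
  refine ENNReal.toReal_le_of_le_ofReal ?_ ?_
  · exact mul_nonneg (tsum_nonneg fun k => by positivity) (Real.exp_pos _).le
  · rw [unionBoundConst, ← tsum_mul_right, ENNReal.ofReal_tsum_of_nonneg (fun k => by positivity) hsum]
    have : {ω | (fun j => w j ω) ∈ fourierDeviationSet L ν τ} = ⋃ k : ℕ, {ω | (fun j => w j ω) ∈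
      {u : Fin L → UnitAddCircle | τ * √√((k : ℝ) + 1) < |1 / (L : ℝ) * ∑ j, (fourier ((k + 1 : ℕ) : ℤ) (u j)).re -
          ∫ x, (fourier ((k + 1 : ℕ) : ℤ) x).re ∂ν|} ∪
      {u | τ * √√((k : ℝ) + 1) < |1 / (L : ℝ) * ∑ j, (fourier ((k + 1 : ℕ) : ℤ) (u j)).im -
          ∫ x, (fourier ((k + 1 : ℕ) : ℤ) x).im ∂ν|}} := by
      ext ω
      simp only [fourierDeviationSet, Set.mem_iUnion, Set.mem_ofPred_eq]
    rw [this]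
    refine (measure_iUnion_le _).trans (ENNReal.tsum_le_tsum fun k => ?_)
    rw [ENNReal.le_ofReal_iff_toReal_le (measure_ne_top _ _) (by positivity)]
    exact hbound k

/-- Outside `fourierDeviationSet`, empirical averages of Lipschitz observables are close to the
reference integral. -/
theorem abs_average_sub_integral_le_of_notMem {L : ℕ} (hL : 1 ≤ L) {ν : Measure UnitAddCircle}
    [IsProbabilityMeasure ν] {ψ : UnitAddCircle → ℝ} {ψ' : ℝ → ℝ} {B τ : ℝ}
    (hψ : ∀ x : ℝ, HasDerivAt (fun x : ℝ => ψ x) (ψ' x) x) (hψc : Continuous ψ)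
    (hψ' : Continuous ψ') (hB0 : 0 < B) (hB : ∀ x, |ψ' x| ≤ B) (hτ : 0 < τ)
    {u : Fin L → UnitAddCircle} (hu : u ∉ fourierDeviationSet L ν τ) :
    |1 / (L : ℝ) * ∑ j, ψ (u j) - ∫ x, ψ x ∂ν| ≤ 0.56 * B * τ := by
  have hdirac : ∀ {E : Type} [NormedAddCommGroup E] [NormedSpace ℝ E] [CompleteSpace E]
      [SecondCountableTopology E] (g : UnitAddCircle → E), Continuous g →
      ∫ x, g x ∂(averageMeasure fun j => Measure.dirac (u j)) = (1 / (L : ℝ)) • ∑ j, g (u j) := by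
    intro E _ _ _ _ g hg
    rw [integral_averageMeasure]
    · simp only [integral_dirac]
    · intro j
      exact hg.integrable_of_hasCompactSupport (HasCompactSupport.of_compactSpace _)
  have := isProbabilityMeasure_averageMeasure hL fun j => Measure.dirac (u j)
  have key := abs_integral_sub_integral_le_of_fourier hψ hψc hψ' hB0 hB hτ
    (averageMeasure fun j => Measure.dirac (u j)) ν ?_
  · rwa [hdirac ψ hψc] at key
  · intro k hk
    obtain ⟨k, rfl⟩ := Nat.exists_eq_add_of_le' hk
    simp only [fourierDeviationSet, Set.mem_iUnion, Set.mem_union, Set.mem_ofPred_eq, not_exists,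
      not_or, not_lt] at hu
    obtain ⟨h1, h2⟩ := hu k
    have hc : Continuous fun x : UnitAddCircle => fourier ((k + 1 : ℕ) : ℤ) x := by fun_prop
    have hint : Integrable (fun x : UnitAddCircle => fourier ((k + 1 : ℕ) : ℤ) x) ν :=
      hc.integrable_of_hasCompactSupport (HasCompactSupport.of_compactSpace _)
    rw [hdirac _ hc]
    set D : ℂ := (1 / (L : ℝ)) • ∑ j, fourier ((k + 1 : ℕ) : ℤ) (u j) -
      ∫ x, fourier ((k + 1 : ℕ) : ℤ) x ∂ν with hD
    have hre : D.re = 1 / (L : ℝ) * ∑ j, (fourier ((k + 1 : ℕ) : ℤ) (u j)).re -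
        ∫ x, (fourier ((k + 1 : ℕ) : ℤ) x).re ∂ν := by
      rw [hD, Complex.sub_re, Complex.real_smul, Complex.re_ofReal_mul, Complex.re_sum]
      congr 1
      exact (integral_re hint).symm
    have him : D.im = 1 / (L : ℝ) * ∑ j, (fourier ((k + 1 : ℕ) : ℤ) (u j)).im -
        ∫ x, (fourier ((k + 1 : ℕ) : ℤ) x).im ∂ν := by
      rw [hD, Complex.sub_im, Complex.real_smul, Complex.im_ofReal_mul, Complex.im_sum]
      congr 1
      exact (integral_im hint).symm
    -- Squaring the two threshold bounds and adding them gives the factor 2 in 2τ²√k.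
    rw [← hre] at h1
    rw [← him] at h2
    have h1' := pow_le_pow_left₀ (abs_nonneg _) h1 2
    have h2' := pow_le_pow_left₀ (abs_nonneg _) h2 2
    rw [sq_abs, mul_pow, Real.sq_sqrt (Real.sqrt_nonneg _)] at h1' h2'
    rw [Complex.sq_norm, Complex.normSq_apply]
    push_cast
    linarith

end Concentration

/-! ### A law of large numbers for observables of finitely many noise steps -/

theorem sum_range_mul_eq_sum_sum (f : ℕ → ℝ) (n m : ℕ) :
    ∑ s ∈ Finset.range (n * m), f s = ∑ r ∈ Finset.range n, ∑ i ∈ Finset.range m, f (r + n * i) := by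
  induction m with
  | zero => simp
  | succ m ih =>
    rw [Nat.mul_succ, Finset.sum_range_add, ih, ← Finset.sum_add_distrib]
    exact Finset.sum_congr rfl fun r _ => by rw [Finset.sum_range_succ, add_comm r (n * m)]

section LawOfLargeNumbers

variable {Ω ι : Type*} [MeasurableSpace Ω] {P : Measure Ω} {θ : Ω → Ω}
  {φ : ι → ℕ → Ω → UnitAddCircle → UnitAddCircle}

/-- θ is not assumed ergodic. Times congruent mod n have disjoint noise windows, so along each
residue class the observable is pairwise independent and identically distributed, and the strong law
applies. -/
theorem ae_eventually_sum_range_le [IsProbabilityMeasure P] (hθ : MeasurePreserving θ P P)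
    (hrds : ∀ i, IsRDS θ (φ i)) (hnodes : IIDNodeMaps P θ φ) {n : ℕ} (hn : 1 ≤ n) {u : Ω → ℝ}
    (hu : ∀ s, Measurable[nodeSigma θ φ {q | s ≤ q.1 ∧ q.1 < s + n}] (fun ω => u (θ^[s] ω)))
    (hint : Integrable u P) (hu0 : ∀ ω, 0 ≤ u ω) :
    ∀ᵐ ω ∂P, ∀ η > 0, ∀ᶠ T : ℕ in atTop,
      ∑ s ∈ Finset.range T, u (θ^[s] ω) ≤ (∫ ω, u ω ∂P + η) * T := by
  have hum : ∀ s, Measurable (fun ω => u (θ^[s] ω)) := fun s =>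
    (hu s).mono (nodeSigma_le hθ.measurable hrds _) le_rfl
  have hcomp : ∀ s, ∫ ω, u (θ^[s] ω) ∂P = ∫ ω, u ω ∂P := fun s => by
    have h := integral_map (μ := P) (f := u) (hθ.iterate s).measurable.aemeasurable
      (hum 0).aestronglyMeasurable
    rw [(hθ.iterate s).map_eq] at h
    exact h.symm
  have hlln : ∀ r : ℕ, ∀ᵐ ω ∂P, Tendsto
      (fun m : ℕ => (∑ i ∈ Finset.range m, u (θ^[r + n * i] ω)) / m) atTop (nhds (∫ ω, u ω ∂P)) := by
    intro r
    have h := strong_law_ae_real (μ := P) (fun i ω => u (θ^[r + n * i] ω)) ?_ ?_ ?_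
    · filter_upwards [h] with ω hω
      rw [← hcomp (r + n * 0)]
      exact hω
    · exact (hθ.iterate (r + n * 0)).integrable_comp_of_integrable hint
    · intro i j hij
      have hdisj : Disjoint {q : ℕ × ι | r + n * i ≤ q.1 ∧ q.1 < r + n * i + n}
          {q : ℕ × ι | r + n * j ≤ q.1 ∧ q.1 < r + n * j + n} := by
        rw [Set.disjoint_left]
        rintro q ⟨h1, h2⟩ ⟨h3, h4⟩
        rcases lt_or_gt_of_ne hij with h | h
        · have := Nat.mul_le_mul_left n (Nat.succ_le_of_lt h)
          rw [Nat.mul_succ] at this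
          omega
        · have := Nat.mul_le_mul_left n (Nat.succ_le_of_lt h)
          rw [Nat.mul_succ] at this
          omega
      have hind := indep_nodeSigma hθ.measurable hrds hnodes hdisj
      refine (IndepFun_iff_Indep _ _ _).2 ?_
      exact indep_of_indep_of_le_left (indep_of_indep_of_le_right hind (hu _).comap_le)
        (hu _).comap_le
    · intro i
      have hid : ∀ s, IdentDistrib (fun ω => u (θ^[s] ω)) u P P := fun s => by
        refine ⟨(hum s).aemeasurable, (hum 0).aemeasurable, ?_⟩
        have h := Measure.map_map (μ := P) (g := u) (hum 0) (hθ.iterate s).measurable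
        rw [(hθ.iterate s).map_eq] at h
        exact h.symm
      exact (hid _).trans (hid _).symm
  filter_upwards [ae_all_iff.2 hlln] with ω hω η hη
  set p := ∫ ω, u ω ∂P
  have hp : 0 ≤ p := integral_nonneg hu0
  have h1 : ∀ᶠ m : ℕ in atTop, ∀ r ∈ Finset.range n,
      ∑ i ∈ Finset.range m, u (θ^[r + n * i] ω) ≤ (p + η / 2) * m := by
    rw [eventually_all_finset]
    intro r _
    filter_upwards [(hω r).eventually_lt_const (show p < p + η / 2 by linarith),
      eventually_gt_atTop 0] with m hm hm0
    have hm0 : (0 : ℝ) < m := by exact_mod_cast hm0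
    rw [div_lt_iff₀ hm0] at hm
    exact hm.le
  -- As u ≥ 0, the sum may be extended to the next multiple of n strictly above T; the at most n
  -- extra terms are absorbed in η.
  have h2 : Tendsto (fun T : ℕ => T / n + 1) atTop atTop :=
    (tendsto_add_atTop_nat 1).comp (Nat.tendsto_div_const_atTop (by omega))
  obtain ⟨N, hN⟩ := exists_nat_ge ((p + η / 2) * n / (η / 2))
  filter_upwards [h2.eventually h1, eventually_ge_atTop N] with T hT hTN
  have hTn : T ≤ n * (T / n + 1) := by
    have h3 := Nat.div_add_mod T n
    have h4 := Nat.mod_lt T hn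
    rw [Nat.mul_succ]
    omega
  have hnT : ((n * (T / n + 1) : ℕ) : ℝ) ≤ T + n := by
    have h5 : n * (T / n + 1) ≤ T + n := by
      rw [Nat.mul_succ]
      exact Nat.add_le_add_right (Nat.mul_div_le T n) n
    exact_mod_cast h5
  have h6 : (p + η / 2) * n ≤ η / 2 * T := by
    rw [div_le_iff₀ (by positivity)] at hN
    have : (N : ℝ) ≤ T := by exact_mod_cast hTN
    nlinarith
  calc ∑ s ∈ Finset.range T, u (θ^[s] ω)
      ≤ ∑ s ∈ Finset.range (n * (T / n + 1)), u (θ^[s] ω) :=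
        Finset.sum_le_sum_of_subset_of_nonneg (Finset.range_subset_range.2 hTn) fun _ _ _ => hu0 _
    _ = ∑ r ∈ Finset.range n, ∑ i ∈ Finset.range (T / n + 1), u (θ^[r + n * i] ω) :=
        sum_range_mul_eq_sum_sum _ _ _
    _ ≤ ∑ r ∈ Finset.range n, (p + η / 2) * ((T / n + 1 : ℕ) : ℝ) := Finset.sum_le_sum hT
    _ = (p + η / 2) * ((n * (T / n + 1) : ℕ) : ℝ) := by
        rw [Finset.sum_const, Finset.card_range, nsmul_eq_mul]
        push_cast
        ring
    _ ≤ (p + η / 2) * (T + n) := by gcongr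
    _ ≤ (p + η) * T := by linarith

end LawOfLargeNumbers

/-! ### The star network -/

theorem UnitAddCircle.norm_coe_le_abs (x : ℝ) : ‖(x : UnitAddCircle)‖ ≤ |x| := by
  rw [UnitAddCircle.norm_eq]
  simpa using round_le x 0

theorem IsC4.hasDerivAt_right {g : UnitAddCircle → UnitAddCircle → ℝ} (hg : IsC4 g) (x y : ℝ) :
    HasDerivAt (fun y : ℝ => g (x : UnitAddCircle) (y : UnitAddCircle)) (mixedDeriv g 0 1 x y) y := by
  simpa [mixedDeriv] using hasDerivAt_iteratedDeriv_of_contDiff (n := 4) (k := 0)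
    (hg.contDiff_right x) (by norm_num) y

theorem IsC4.continuous_mixedDeriv_right {g : UnitAddCircle → UnitAddCircle → ℝ} (hg : IsC4 g)
    (x : ℝ) : Continuous fun y : ℝ => mixedDeriv g 0 1 x y := by
  have h1 := hg.continuous_mixedDeriv (a := 0) (b := 1) (by norm_num)
  have hc : Continuous fun r : ℝ => (x, r) := by fun_prop
  have h2 := h1.comp hc
  simpa only [Function.comp_def] using h2

theorem IsC4.abs_mixedDeriv_le_lipConst {g : UnitAddCircle → UnitAddCircle → ℝ} (hg : IsC4 g)
    (x y : ℝ) : |mixedDeriv g 0 1 x y| ≤ lipConst g := by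
  have hd := hg.hasDerivAt_right x y
  have hlip : LipschitzWith (lipConst g).toNNReal
      (fun y : ℝ => g (x : UnitAddCircle) (y : UnitAddCircle)) := by
    refine LipschitzWith.of_dist_le' fun a b => ?_
    have h := hg.abs_sub_le_lipConst ((x : UnitAddCircle), (a : UnitAddCircle)) (x, b)
    refine h.trans (mul_le_mul_of_nonneg_left ?_ (lipConst_nonneg g))
    rw [Prod.dist_eq, dist_self, max_eq_right dist_nonneg, dist_eq_norm, ← AddCircle.coe_sub]
    exact UnitAddCircle.norm_coe_le_abs _
  have := hd.le_of_lipschitz hlip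
  rwa [Real.coe_toNNReal _ (lipConst_nonneg g)] at this

theorem limsup_le_of_forall_eventually_le_add {f : ℕ → ℝ} {p : ℝ} (hf : ∀ T, 0 ≤ f T)
    (h : ∀ η > 0, ∀ᶠ T in atTop, f T ≤ p + η) : limsup f atTop ≤ p := by
  refine le_of_forall_pos_le_add fun η hη => ?_
  exact limsup_le_of_le (isCoboundedUnder_le_of_le atTop hf) (h η hη)

section Network

variable {Ω : Type*} {L : ℕ} {θ : Ω → Ω} {φ : Fin (L + 1) → ℕ → Ω → UnitAddCircle → UnitAddCircle}
  {h : Ω → UnitAddCircle → UnitAddCircle → ℝ} {α lam A : ℝ}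

/-- One step contracts the distance by λ and adds a kick of size at most αA/L; the kicks sum as a
geometric series, and the initial distance is at most 1/2. -/
theorem dist_starOrbit_forward_le (hL : 1 ≤ L) (hα : 0 < α) (hlam : lam ∈ Set.Ioo (0 : ℝ) 1)
    (hsucc : ∀ i n ω x, φ i (n + 1) ω x = φ i 1 (θ^[n] ω) (φ i n ω x))
    (hcontr : ∀ i ω x y, dist (φ i 1 ω x) (φ i 1 ω y) ≤ lam * dist x y) {ω : Ω}
    (hA : ∀ t p q, |h (θ^[t] ω) p q| ≤ A) (x : Fin (L + 1) → UnitAddCircle) (s k : ℕ) (j : Fin L) :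
    dist (starOrbit θ φ h α (s + k) ω x j.succ) (φ j.succ k (θ^[s] ω) 0) ≤
      α * A / (L * (1 - lam)) + lam ^ k / 2 := by
  have hL0 : (0 : ℝ) < L := by exact_mod_cast hL
  have hl : 0 < 1 - lam := sub_pos.2 hlam.2
  have hA0 : 0 ≤ A := (abs_nonneg _).trans (hA 0 0 0)
  induction k with
  | zero =>
    have := UnitAddCircle.dist_le_half (starOrbit θ φ h α (s + 0) ω x j.succ)
      (φ j.succ 0 (θ^[s] ω) 0)
    have h2 : 0 ≤ α * A / (L * (1 - lam)) := by positivity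
    rw [pow_zero]
    linarith
  | succ k ih =>
    rw [← add_assoc, hsucc, ← Function.iterate_add_apply, add_comm k s]
    simp only [starOrbit, starStep, Fin.cons_succ]
    set y := starOrbit θ φ h α (s + k) ω x with hy
    set c : ℝ := α * (1 / (L : ℝ) * h (θ^[s + k] ω) (y j.succ) (y 0)) with hc
    have hcb : |c| ≤ α * A / L := by
      rw [hc, abs_mul, abs_mul, abs_of_pos hα, abs_of_pos (by positivity : (0 : ℝ) < 1 / L)]
      have := hA (s + k) (y j.succ) (y 0)
      calc α * (1 / (L : ℝ) * |h (θ^[s + k] ω) (y j.succ) (y 0)|) ≤ α * (1 / (L : ℝ) * A) := by gcongr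
        _ = α * A / L := by ring
    have h1 : dist (φ j.succ 1 (θ^[s + k] ω) (y j.succ) + (c : UnitAddCircle))
        (φ j.succ 1 (θ^[s + k] ω) (φ j.succ k (θ^[s] ω) 0)) ≤
        |c| + lam * dist (y j.succ) (φ j.succ k (θ^[s] ω) 0) := by
      refine (dist_triangle _ (φ j.succ 1 (θ^[s + k] ω) (y j.succ)) _).trans ?_
      refine add_le_add ?_ (hcontr _ _ _ _)
      rw [dist_eq_norm, add_sub_cancel_left]
      exact UnitAddCircle.norm_coe_le_abs c
    refine h1.trans ?_
    have h2 := mul_le_mul_of_nonneg_left ih hlam.1.le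
    -- The accumulated drift is the fixed point of r ↦ αA/L + λr, so the induction closes.
    have h3 : α * A / (L * (1 - lam)) = α * A / L + lam * (α * A / (L * (1 - lam))) := by
      field_simp
      ring
    rw [pow_succ]
    linarith

theorem abs_average_sub_average_le {ψ : UnitAddCircle → ℝ} {B δ : ℝ} (hL : 1 ≤ L) (hB : 0 ≤ B)
    (hψ : ∀ p q, |ψ p - ψ q| ≤ B * dist p q) {u v : Fin L → UnitAddCircle}
    (huv : ∀ j, dist (u j) (v j) ≤ δ) :
    |1 / (L : ℝ) * ∑ j, ψ (u j) - 1 / (L : ℝ) * ∑ j, ψ (v j)| ≤ B * δ := by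
  have hL0 : (0 : ℝ) < L := by exact_mod_cast hL
  rw [← mul_sub, ← Finset.sum_sub_distrib, abs_mul, abs_of_pos (by positivity : (0 : ℝ) < 1 / L)]
  have h1 : |∑ j, (ψ (u j) - ψ (v j))| ≤ ∑ _j : Fin L, B * δ :=
    (Finset.abs_sum_le_sum_abs _ _).trans (Finset.sum_le_sum fun j _ =>
      (hψ _ _).trans (mul_le_mul_of_nonneg_left (huv j) hB))
  rw [Finset.sum_const, Finset.card_univ, Fintype.card_fin, nsmul_eq_mul] at h1
  calc 1 / (L : ℝ) * |∑ j, (ψ (u j) - ψ (v j))| ≤ 1 / (L : ℝ) * (L * (B * δ)) := by gcongr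
    _ = B * δ := by field_simp

/-- If a bad time `s + n` forces `θ^s ω` into an event visited with frequency at most `p`, then the
exceptional frequency is at most `p`. -/
theorem admitsReduction_of_forall_mem {m : Measure UnitAddCircle} {ε p : ℝ} {ω : Ω}
    {x : Fin (L + 1) → UnitAddCircle} {E : Set Ω} {n : ℕ}
    (hE : ∀ s, ¬ AdmitsReductionAt θ φ h α m ε ω x (s + n) → θ^[s] ω ∈ E)
    (hfreq : ∀ η > 0, ∀ᶠ T : ℕ in atTop,
      ∑ s ∈ Finset.range T, E.indicator (fun _ => (1 : ℝ)) (θ^[s] ω) ≤ (p + η) * T) :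
    AdmitsReduction θ φ h α m ε p ω x := by
  classical
  refine limsup_le_of_forall_eventually_le_add (fun T => by positivity) fun η hη => ?_
  obtain ⟨N, hN⟩ := exists_nat_ge (n / (η / 2))
  filter_upwards [hfreq (η / 2) (half_pos hη), eventually_ge_atTop N, eventually_gt_atTop 0]
    with T hT hTN hT0
  have hT0 : (0 : ℝ) < T := by exact_mod_cast hT0
  rw [div_le_iff₀ hT0]
  -- Times before n have no restart time s = t - n; they contribute at most n, negligible against T.
  have hsub : (Finset.range T).filter (fun t => ¬ AdmitsReductionAt θ φ h α m ε ω x t) ⊆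
      Finset.range n ∪ ((Finset.range T).filter fun s => θ^[s] ω ∈ E).image (· + n) := by
    intro t ht
    rw [Finset.mem_filter, Finset.mem_range] at ht
    rw [Finset.mem_union, Finset.mem_range, Finset.mem_image]
    rcases lt_or_ge t n with h1 | h1
    · exact Or.inl h1
    · obtain ⟨s, rfl⟩ := Nat.exists_eq_add_of_le' h1
      refine Or.inr ⟨s, ?_, rfl⟩
      rw [Finset.mem_filter, Finset.mem_range]
      exact ⟨by omega, hE s ht.2⟩
  have hcard := (Finset.card_le_card hsub).trans
    ((Finset.card_union_le _ _).trans (Nat.add_le_add_left Finset.card_image_le _))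
  rw [Finset.card_range] at hcard
  have hsum : ∑ s ∈ Finset.range T, E.indicator (fun _ => (1 : ℝ)) (θ^[s] ω) =
      (((Finset.range T).filter fun s => θ^[s] ω ∈ E).card : ℝ) := by
    simp [Set.indicator_apply, Finset.sum_boole]
  rw [hsum] at hT
  have hn : (n : ℝ) ≤ η / 2 * T := by
    rw [div_le_iff₀ (half_pos hη)] at hN
    have : (N : ℝ) ≤ T := by exact_mod_cast hTN
    nlinarith
  have hcard' : (((Finset.range T).filter (fun t => ¬ AdmitsReductionAt θ φ h α m ε ω x t)).card : ℝ)
      ≤ n + (((Finset.range T).filter fun s => θ^[s] ω ∈ E).card : ℝ) := by exact_mod_cast hcard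
  convert hcard'.trans (by linarith : _ ≤ (p + η) * T)

end Network

/-! ### Large fluctuations force a deviation event -/

section Deviation

variable {Ω : Type*} [MeasurableSpace Ω] {P : Measure Ω} {L : ℕ} {θ : Ω → Ω}
  {φ : Fin (L + 1) → ℕ → Ω → UnitAddCircle → UnitAddCircle}
  {h : Ω → UnitAddCircle → UnitAddCircle → ℝ} {α lam : ℝ}

/-- The law of the low-degree nodes after `n` uncoupled steps from `0`, averaged over the nodes. -/
noncomputable def nodeLaw (P : Measure Ω) (φ : Fin (L + 1) → ℕ → Ω → UnitAddCircle → UnitAddCircle)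
    (n : ℕ) : Measure UnitAddCircle :=
  averageMeasure fun j : Fin L => P.map fun ω => φ j.succ n ω 0

/-- The event that the uncoupled low-degree nodes deviate from their law after `n` steps. -/
def deviationEvent (P : Measure Ω) (φ : Fin (L + 1) → ℕ → Ω → UnitAddCircle → UnitAddCircle)
    (n : ℕ) (τ : ℝ) : Set Ω :=
  {ω | (fun j : Fin L => φ j.succ n ω 0) ∈ fourierDeviationSet L (nodeLaw P φ n) τ}

theorem measurable_forward_zero {ψ : ℕ → Ω → UnitAddCircle → UnitAddCircle} (hψ : IsRDS θ ψ) (n : ℕ) :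
    Measurable fun ω => ψ n ω 0 :=
  (hψ.measurable n).comp (measurable_id.prodMk measurable_const)

theorem isProbabilityMeasure_nodeLaw [IsProbabilityMeasure P] (hL : 1 ≤ L)
    (hrds : ∀ i, IsRDS θ (φ i)) (n : ℕ) : IsProbabilityMeasure (nodeLaw P φ n) := by
  have : ∀ j : Fin L, IsProbabilityMeasure (P.map fun ω => φ j.succ n ω 0) := fun j =>
    Measure.isProbabilityMeasure_map (measurable_forward_zero (hrds _) n).aemeasurable
  exact isProbabilityMeasure_averageMeasure hL _

theorem measureReal_deviationEvent_le [IsProbabilityMeasure P] (hθ : MeasurePreserving θ P P)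
    (hL : 1 ≤ L) (hrds : ∀ i, IsRDS θ (φ i))
    (hcontr : ∀ i ω x y, dist (φ i 1 ω x) (φ i 1 ω y) ≤ lam * dist x y)
    (hnodes : IIDNodeMaps P θ φ) (n : ℕ) {τ : ℝ} (hτ : 0 ≤ τ) (hτL : 1 / 2 ≤ L * τ ^ 2 / 2) :
    P.real (deviationEvent P φ n τ) ≤ unionBoundConst * Real.exp (-(L * τ ^ 2 / 2)) := by
  have hind : iIndepFun (fun j ω => φ j n ω 0) P :=
    iIndepFun_of_measurable_nodeSigma hθ.measurable hrds hnodes fun j =>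
      measurable_forward (hrds j).zero (hrds j).succ hcontr 0 n 0 fun k _ => rfl
  exact measureReal_fourierDeviationSet_le hL (fun j => measurable_forward_zero (hrds _) n)
    (hind.precomp (Fin.succ_injective L)) hτ hτL

theorem ae_eventually_sum_deviationEvent_le [IsProbabilityMeasure P] (hθ : MeasurePreserving θ P P)
    (hrds : ∀ i, IsRDS θ (φ i))
    (hcontr : ∀ i ω x y, dist (φ i 1 ω x) (φ i 1 ω y) ≤ lam * dist x y)
    (hnodes : IIDNodeMaps P θ φ) {n : ℕ} (hn : 1 ≤ n) (τ : ℝ) :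
    ∀ᵐ ω ∂P, ∀ η > 0, ∀ᶠ T : ℕ in atTop,
      ∑ s ∈ Finset.range T, (deviationEvent P φ n τ).indicator (fun _ => (1 : ℝ)) (θ^[s] ω) ≤
        (P.real (deviationEvent P φ n τ) + η) * T := by
  have hmeas : ∀ s, MeasurableSet[nodeSigma θ φ {q | s ≤ q.1 ∧ q.1 < s + n}]
      {ω | θ^[s] ω ∈ deviationEvent P φ n τ} := by
    intro s
    have hw : ∀ j : Fin L, Measurable[nodeSigma θ φ {q | s ≤ q.1 ∧ q.1 < s + n}]
        (fun ω => φ j.succ n (θ^[s] ω) 0) := fun j =>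
      measurable_forward (hrds j.succ).zero (hrds j.succ).succ hcontr s n 0 fun k hk =>
        ⟨Nat.le_add_right s k, Nat.add_lt_add_left hk s⟩
    exact (@measurable_pi_lambda _ _ _ (nodeSigma θ φ {q | s ≤ q.1 ∧ q.1 < s + n}) _ _ hw)
      (measurableSet_fourierDeviationSet L (nodeLaw P φ n) τ)
  have hE : MeasurableSet (deviationEvent P φ n τ) := nodeSigma_le hθ.measurable hrds _ _ (hmeas 0)
  have key := ae_eventually_sum_range_le hθ hrds hnodes hn
    (u := (deviationEvent P φ n τ).indicator fun _ => (1 : ℝ)) (fun s => ?_) ?_ ?_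
  · rwa [integral_indicator_const _ hE, smul_eq_mul, mul_one] at key
  · change Measurable[nodeSigma θ φ {q | s ≤ q.1 ∧ q.1 < s + n}]
      ({ω | θ^[s] ω ∈ deviationEvent P φ n τ}.indicator fun _ => (1 : ℝ))
    exact Measurable.indicator measurable_const (hmeas s)
  · exact (integrable_const 1).indicator hE
  · exact fun ω => Set.indicator_nonneg (fun _ _ => zero_le_one) ω

theorem abs_integral_nodeLaw_sub_le [IsProbabilityMeasure P]
    (hθ : MeasurePreserving θ P P) (hL : 1 ≤ L) (hlam : lam ∈ Set.Ioo (0 : ℝ) 1)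
    (hrds : ∀ i, IsRDS θ (φ i))
    (hcontr : ∀ i ω x y, dist (φ i 1 ω x) (φ i 1 ω y) ≤ lam * dist x y)
    (hnodes : IIDNodeMaps P θ φ) {m : Measure UnitAddCircle}
    (hm : ∀ i, IsStationaryMeasure P (φ i) m) (n : ℕ) {ψ : UnitAddCircle → ℝ} {B : ℝ} (hB : 0 ≤ B)
    (hψ : ∀ p q, |ψ p - ψ q| ≤ B * dist p q) :
    |∫ p, ψ p ∂nodeLaw P φ n - ∫ p, ψ p ∂m| ≤ B * lam ^ n / 2 := by
  have hL0 : (0 : ℝ) < L := by exact_mod_cast hL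
  have hprob : ∀ j : Fin L, IsProbabilityMeasure (P.map fun ω => φ j.succ n ω 0) := fun j =>
    Measure.isProbabilityMeasure_map (measurable_forward_zero (hrds _) n).aemeasurable
  have h0 : ∫ p, ψ p ∂nodeLaw P φ n =
      (1 / (L : ℝ)) • ∑ j : Fin L, ∫ p, ψ p ∂(P.map fun ω => φ j.succ n ω 0) :=
    integral_averageMeasure _ fun j =>
      integrable_of_abs_sub_le hB hψ (u := fun p => p) measurable_id
  have h1 : ∀ j : Fin L, |∫ p, ψ p ∂(P.map fun ω => φ j.succ n ω 0) - ∫ p, ψ p ∂m| ≤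
      B * lam ^ n / 2 := by
    intro j
    rw [integral_map (measurable_forward_zero (hrds j.succ) n).aemeasurable
      (continuous_of_abs_sub_le hψ).aestronglyMeasurable]
    exact abs_integral_forward_sub_le hθ hlam hrds hcontr hnodes j.succ (hm _) 0 n hB hψ
  have h2 : ∫ p, ψ p ∂nodeLaw P φ n - ∫ p, ψ p ∂m = 1 / (L : ℝ) * ∑ j : Fin L,
      (∫ p, ψ p ∂(P.map fun ω => φ j.succ n ω 0) - ∫ p, ψ p ∂m) := by
    rw [h0, smul_eq_mul, Finset.sum_sub_distrib, Finset.sum_const, Finset.card_univ,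
      Fintype.card_fin, nsmul_eq_mul]
    field_simp
  rw [h2, abs_mul, abs_of_pos (by positivity : (0 : ℝ) < 1 / L)]
  have h3 := (Finset.abs_sum_le_sum_abs (fun j : Fin L =>
    (∫ p, ψ p ∂(P.map fun ω => φ j.succ n ω 0) - ∫ p, ψ p ∂m)) Finset.univ).trans
    (Finset.sum_le_sum fun j _ => h1 j)
  rw [Finset.sum_const, Finset.card_univ, Fintype.card_fin, nsmul_eq_mul] at h3
  calc _ ≤ 1 / (L : ℝ) * (L * (B * lam ^ n / 2)) := by gcongr
    _ = B * lam ^ n / 2 := by field_simp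

/-- Off the event the error, divided by α, has four parts: coupling drift at most d/4 by `hd`,
forgotten initial state Bλ^n/2, empirical deviation 0.56 Bτ, and distance of the node law to m of
Bλ^n/2. The event concerns all modes at once, so the dependence of g and the hub position on the
nodes is harmless. -/
theorem mem_deviationEvent_of_lt_abs_fluctuation [IsProbabilityMeasure P]
    (hθ : MeasurePreserving θ P P) (hL : 1 ≤ L) (hα : 0 < α) (hlam : lam ∈ Set.Ioo (0 : ℝ) 1)
    (hrds : ∀ i, IsRDS θ (φ i))
    (hcontr : ∀ i ω x y, dist (φ i 1 ω x) (φ i 1 ω y) ≤ lam * dist x y)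
    (hnodes : IIDNodeMaps P θ φ) (hsmooth : ∀ ω, IsC4 (h ω)) {m : Measure UnitAddCircle}
    (hm : ∀ i, IsStationaryMeasure P (φ i) m) {ω : Ω} {A B τ d : ℝ}
    (hA : ∀ t, normC0 (h (θ^[t] ω)) ≤ A) (hB : ∀ t, lipConst (h (θ^[t] ω)) ≤ B) (hB0 : 0 < B)
    (hτ : 0 < τ) (hd : 4 * α * A * B ≤ d * (L * (1 - lam))) {n : ℕ}
    (hn : d / 4 + B * lam ^ n + 0.56 * B * τ ≤ d) (x : Fin (L + 1) → UnitAddCircle) (s : ℕ)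
    (hbad : α * d < |fluctuation h α m (θ^[s + n] ω) (starOrbit θ φ h α (s + n) ω x)|) :
    θ^[s] ω ∈ deviationEvent P φ n τ := by
  by_contra hnot
  refine absurd hbad (not_lt.2 ?_)
  have hL0 : (0 : ℝ) < L := by exact_mod_cast hL
  have hl : 0 < 1 - lam := sub_pos.2 hlam.2
  have := (hm 0).isProb
  have hνprob := isProbabilityMeasure_nodeLaw (P := P) hL hrds n
  set g := h (θ^[s + n] ω) with hg
  have hg4 : IsC4 g := hsmooth _
  set y := starOrbit θ φ h α (s + n) ω x with hy
  set w : Fin L → UnitAddCircle := fun j => φ j.succ n (θ^[s] ω) 0 with hw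
  have hψ : ∀ p q, |g (y 0) p - g (y 0) q| ≤ B * dist p q := by
    intro p q
    refine (hg4.abs_sub_le_lipConst (y 0, p) (y 0, q)).trans ?_
    rw [Prod.dist_eq, dist_self, max_eq_right dist_nonneg]
    exact mul_le_mul_of_nonneg_right (hB _) dist_nonneg
  obtain ⟨z, hz⟩ := QuotientAddGroup.mk_surjective (y 0)
  have e1 : |1 / (L : ℝ) * ∑ j : Fin L, g (y 0) (y j.succ) - 1 / (L : ℝ) * ∑ j, g (y 0) (w j)| ≤
      B * (α * A / (L * (1 - lam)) + lam ^ n / 2) :=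
    abs_average_sub_average_le (ψ := fun p => g (y 0) p) (u := fun j => y j.succ) hL hB0.le hψ
      fun j => dist_starOrbit_forward_le hL hα hlam (fun i => (hrds i).succ) hcontr
        (fun t p q => ((hsmooth _).abs_le_normC0 p q).trans (hA t))
        x s n j
  have e2 : |1 / (L : ℝ) * ∑ j, g (y 0) (w j) - ∫ p, g (y 0) p ∂nodeLaw P φ n| ≤ 0.56 * B * τ := by
    refine abs_average_sub_integral_le_of_notMem hL (ψ := fun p => g (y 0) p)
      (ψ' := fun r => mixedDeriv g 0 1 z r) (fun r => ?_) (continuous_of_abs_sub_le hψ) ?_ hB0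
      (fun r => (hg4.abs_mixedDeriv_le_lipConst z r).trans (hB _)) hτ hnot
    · rw [← hz]
      exact hg4.hasDerivAt_right z r
    · exact hg4.continuous_mixedDeriv_right z
  have e3 : |∫ p, g (y 0) p ∂nodeLaw P φ n - ∫ p, g (y 0) p ∂m| ≤ B * lam ^ n / 2 :=
    abs_integral_nodeLaw_sub_le hθ hL hlam hrds hcontr hnodes hm n (ψ := fun p => g (y 0) p) hB0.le hψ
  have e4 : B * (α * A / (L * (1 - lam))) ≤ d / 4 := by
    rw [← mul_div_assoc, div_le_div_iff₀ (by positivity) (by norm_num)]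
    linarith
  rw [fluctuation, abs_mul, abs_of_pos hα]
  refine mul_le_mul_of_nonneg_left ?_ hα.le
  have e5 := abs_sub_le (1 / (L : ℝ) * ∑ j : Fin L, g (y 0) (y j.succ))
    (1 / (L : ℝ) * ∑ j, g (y 0) (w j)) (∫ p, g (y 0) p ∂m)
  have e6 := abs_sub_le (1 / (L : ℝ) * ∑ j, g (y 0) (w j)) (∫ p, g (y 0) p ∂nodeLaw P φ n)
    (∫ p, g (y 0) p ∂m)
  linarith

end Deviation

/-! ### The exceptional frequency -/

theorem unionBoundConst_nonneg : 0 ≤ unionBoundConst := tsum_nonneg fun k => by positivity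

/-- The absolute constant in front of the exceptional frequency. -/
noncomputable def reductionConst : ℝ := 16 + 640 * unionBoundConst

theorem reductionConst_pos : 0 < reductionConst := by
  have := unionBoundConst_nonneg
  unfold reductionConst
  positivity

/-- The deviation probability is dominated by the exceptional frequency of the theorem. The factor
`ε⁻¹` is controlled through `B ^ 2 ≤ 32 * A * H` and the lower bound on `ε` in terms of `A * B`. -/
theorem deviation_bound_le {L A B H α ε lam τ p : ℝ} (hL : 1 ≤ L) (hα : 0 < α) (hε : 0 < ε)
    (hlam : lam ∈ Set.Ioo (0 : ℝ) 1) (hB : 0 < B) (hBH : 32 * B ≤ H)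
    (hBA : B ^ 2 ≤ 32 * A * H) (h1 : α ^ 2 ≤ L * ε ^ 2)
    (h2 : 4 * α ^ 2 * A * B ≤ ε * (L * (1 - lam))) (hτ : 1.1 * (ε / α / B) ≤ τ) (hp1 : p ≤ 1)
    (hp : 1 / 2 ≤ L * τ ^ 2 / 2 → p ≤ unionBoundConst * Real.exp (-(L * τ ^ 2 / 2))) :
    p ≤ reductionConst * ε⁻¹ * H * Real.exp (-(L * ε ^ 2 * α⁻¹ ^ 2 * (450 / H ^ 2))) := by
  have hH : 0 < H := by linarith
  have hL0 : 0 < L := by linarith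
  have hK := unionBoundConst_nonneg
  set w := L * ε ^ 2 / (α ^ 2 * B ^ 2) with hw
  have hw0 : 0 < w := by positivity
  have hwB : 1 ≤ w * B ^ 2 := by
    rw [hw, div_mul_eq_mul_div, le_div_iff₀ (by positivity)]
    nlinarith [sq_nonneg B]
  -- From H ≥ 32 B, 450 B²/H² ≤ 450/1024 < 0.44.
  have hexp : Real.exp (-(0.44 * w)) ≤ Real.exp (-(L * ε ^ 2 * α⁻¹ ^ 2 * (450 / H ^ 2))) := by
    rw [Real.exp_le_exp, neg_le_neg_iff]
    have e : L * ε ^ 2 * α⁻¹ ^ 2 * (450 / H ^ 2) = w * (450 * B ^ 2 / H ^ 2) := by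
      rw [hw]
      field_simp
    rw [e, mul_comm]
    refine mul_le_mul_of_nonneg_right ?_ hw0.le
    rw [div_le_iff₀ (by positivity)]
    nlinarith
  -- α²B³ ≤ 32 α²ABH = 8H · 4α²AB ≤ 8HεL, using 1 - λ ≤ 1 in the last step.
  have hHε : B / (8 * w) ≤ ε⁻¹ * H := by
    have h3 : 4 * α ^ 2 * A * B ≤ ε * L := h2.trans (by nlinarith [hlam.1, mul_pos hε hL0])
    have h4 : α ^ 2 * B ^ 3 ≤ 8 * (H * (L * ε)) := by
      have h5 := mul_le_mul_of_nonneg_left hBA (by positivity : 0 ≤ α ^ 2 * B)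
      have h6 := mul_le_mul_of_nonneg_left h3 (by positivity : 0 ≤ 8 * H)
      nlinarith
    have e : B / (8 * w) = α ^ 2 * B ^ 3 / (8 * (L * ε ^ 2)) := by
      rw [hw]
      field_simp
    rw [e, div_le_iff₀ (by positivity)]
    refine h4.trans (le_of_eq ?_)
    field_simp
  have hmain : reductionConst * (B / (8 * w)) * Real.exp (-(0.44 * w)) ≤
      reductionConst * ε⁻¹ * H * Real.exp (-(L * ε ^ 2 * α⁻¹ ^ 2 * (450 / H ^ 2))) := by
    have := reductionConst_pos
    rw [mul_assoc reductionConst ε⁻¹ H]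
    gcongr
  refine le_trans ?_ hmain
  -- For w < 1 the tail bound may be unavailable and p ≤ 1 is used: w B² ≥ 1 forces B ≥ 1, and the
  -- summand 16 of the constant suffices. For w ≥ 1 the exponent 0.605 w exceeds 0.44 w, and the
  -- surplus exp(-0.16 w) pays for the prefactor.
  rcases lt_or_ge w 1 with hw1 | hw1
  · refine hp1.trans ?_
    have hB1 : 1 ≤ B := by
      by_contra hlt
      nlinarith [mul_pos hB hB]
    have e1 : 1 / 8 ≤ B / (8 * w) := by
      rw [div_le_div_iff₀ (by norm_num) (by positivity)]
      linarith
    have e2 : 0.56 ≤ Real.exp (-(0.44 * w)) := by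
      have := Real.add_one_le_exp (-(0.44 * w))
      linarith
    have e3 : 16 ≤ reductionConst := by unfold reductionConst; linarith
    calc (1 : ℝ) ≤ 16 * (1 / 8) * 0.56 := by norm_num
      _ ≤ _ := by gcongr
  · have hLτ : 0.605 * w ≤ L * τ ^ 2 / 2 := by
      have e1 := pow_le_pow_left₀ (by positivity) hτ 2
      have e2 : (1.1 * (ε / α / B)) ^ 2 * L = 1.21 * w := by
        rw [hw]
        field_simp
        norm_num
      nlinarith
    refine (hp (by linarith)).trans ?_
    -- (Bw)² = w · (w B²) ≥ 1.
    have hBw : 1 / w ≤ B := by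
      rw [div_le_iff₀ hw0]
      by_contra hlt
      have : (B * w) ^ 2 < 1 := by
        have : 0 < B * w := by positivity
        nlinarith
      nlinarith
    have e1 : 1 / (8 * w ^ 2) ≤ B / (8 * w) := by
      have e : 1 / (8 * w ^ 2) = 1 / w / (8 * w) := by field_simp
      rw [e]
      gcongr
    have e2 : Real.exp (-(L * τ ^ 2 / 2)) ≤ Real.exp (-(0.16 * w)) * Real.exp (-(0.44 * w)) := by
      rw [← Real.exp_add, Real.exp_le_exp]
      linarith
    -- exp(0.16 w) ≥ (0.16 w)²/2 = 0.0128 w² ≥ w²/80, and 640/8 = 80.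
    have e3 : Real.exp (-(0.16 * w)) ≤ 640 * (1 / (8 * w ^ 2)) := by
      have h5 := Real.pow_div_factorial_le_exp (0.16 * w) (by positivity) 2
      norm_num [Nat.factorial] at h5
      rw [Real.exp_neg, inv_le_comm₀ (Real.exp_pos _) (by positivity)]
      refine le_trans (le_of_eq ?_) (show w ^ 2 / 80 ≤ Real.exp (0.16 * w) from ?_)
      · field_simp
        norm_num
      · norm_num at h5 ⊢
        nlinarith [sq_nonneg w]
    calc unionBoundConst * Real.exp (-(L * τ ^ 2 / 2))
        ≤ unionBoundConst * (640 * (1 / (8 * w ^ 2)) * Real.exp (-(0.44 * w))) := by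
          refine mul_le_mul_of_nonneg_left (e2.trans ?_) hK
          gcongr
      _ = (640 * unionBoundConst) * (1 / (8 * w ^ 2)) * Real.exp (-(0.44 * w)) := by ring
      _ ≤ reductionConst * (B / (8 * w)) * Real.exp (-(0.44 * w)) := by
          have h6 : 640 * unionBoundConst ≤ reductionConst := by unfold reductionConst; linarith
          have h7 := reductionConst_pos
          gcongr

theorem fluctuation_eq_zero_of_lipConst_eq_zero {L : ℕ} (hL : 1 ≤ L) {Ω : Type*}
    {h : Ω → UnitAddCircle → UnitAddCircle → ℝ} {ω : Ω} (hsmooth : IsC4 (h ω))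
    (h0 : lipConst (h ω) = 0) (α : ℝ) (m : Measure UnitAddCircle) [IsProbabilityMeasure m]
    (x : Fin (L + 1) → UnitAddCircle) : fluctuation h α m ω x = 0 := by
  have hL0 : (L : ℝ) ≠ 0 := by exact_mod_cast (by omega : L ≠ 0)
  have hc : ∀ y, h ω (x 0) y = h ω (x 0) 0 := fun y => by
    have := hsmooth.abs_sub_le_lipConst (x 0, y) (x 0, 0)
    rw [h0, zero_mul] at this
    exact sub_eq_zero.1 (abs_nonpos_iff.1 this)
  simp only [fluctuation, hc, Finset.sum_const, Finset.card_univ, Fintype.card_fin, nsmul_eq_mul,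
    integral_const, probReal_univ, one_smul]
  field_simp
  simp

theorem ae_admitsReduction {Ω : Type*} [MeasurableSpace Ω] {P : Measure Ω} [IsProbabilityMeasure P]
    {θ : Ω → Ω} (hθ : MeasurePreserving θ P P) {L : ℕ} (hL : 1 ≤ L)
    {φ : Fin (L + 1) → ℕ → Ω → UnitAddCircle → UnitAddCircle}
    {h : Ω → UnitAddCircle → UnitAddCircle → ℝ} {α lam : ℝ} (hα : 0 < α)
    (hlam : lam ∈ Set.Ioo (0 : ℝ) 1) (hrds : ∀ i, IsRDS θ (φ i))
    (hcontr : ∀ i ω x y, dist (φ i 1 ω x) (φ i 1 ω y) ≤ lam * dist x y)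
    (hnodes : IIDNodeMaps P θ φ) (hsmooth : ∀ ω, IsC4 (h ω)) {m : Measure UnitAddCircle}
    (hm : ∀ i, IsStationaryMeasure P (φ i) m) :
    ∀ᵐ ω ∂P, BddAbove (Set.range fun t : ℕ => normC4 (h (θ^[t] ω))) →
      ∀ ε : ℝ,
        max (α * (L : ℝ) ^ (-(1 / 2) : ℝ))
          (4 * α ^ 2 * (L : ℝ)⁻¹ * (1 - lam)⁻¹ *
            (⨆ t : ℕ, normC0 (h (θ^[t] ω))) * (⨆ t : ℕ, lipConst (h (θ^[t] ω)))) ≤ ε →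
        ∀ x : Fin (L + 1) → UnitAddCircle,
          AdmitsReduction θ φ h α m ε
            ((reductionConst * ε⁻¹ * ⨆ t : ℕ, normC4 (h (θ^[t] ω))) *
              Real.exp (-(L * ε ^ 2 * α⁻¹ ^ 2 *
                (450 / (⨆ t : ℕ, normC4 (h (θ^[t] ω))) ^ 2)))) ω x := by
  -- Only countably many pairs of window length and rational τ are used, so one null set covers
  -- every ε and x.
  have hlln := fun (n : ℕ) (τ : ℚ) => ae_eventually_sum_deviationEvent_le hθ hrds hcontr hnodes
    (Nat.succ_le_succ (Nat.zero_le n)) (τ : ℝ)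
  filter_upwards [ae_all_iff.2 fun n => ae_all_iff.2 fun τ => hlln n τ] with ω hω hbdd ε hε x
  have hprob := (hm 0).isProb
  have hL1 : (1 : ℝ) ≤ L := by exact_mod_cast hL
  have hL0 : (0 : ℝ) < L := by linarith
  have hl : 0 < 1 - lam := sub_pos.2 hlam.2
  set H := ⨆ t : ℕ, normC4 (h (θ^[t] ω)) with hH
  set A := ⨆ t : ℕ, normC0 (h (θ^[t] ω)) with hA
  set B := ⨆ t : ℕ, lipConst (h (θ^[t] ω)) with hB
  have hHt : ∀ t, normC4 (h (θ^[t] ω)) ≤ H := le_ciSup hbdd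
  have hAt : ∀ t, normC0 (h (θ^[t] ω)) ≤ A := le_ciSup ⟨H, by
    rintro _ ⟨t, rfl⟩
    exact (hsmooth _).normC0_le_normC4.trans (hHt t)⟩
  have hBt : ∀ t, lipConst (h (θ^[t] ω)) ≤ B := le_ciSup ⟨H / 32, by
    rintro _ ⟨t, rfl⟩
    exact (hsmooth _).lipConst_le_normC4.trans (by linarith [hHt t])⟩
  have hA0 : 0 ≤ A := (abs_nonneg _).trans (((hsmooth _).abs_le_normC0 0 0).trans (hAt 0))
  have hH0 : 0 ≤ H := (hsmooth _).normC4_nonneg.trans (hHt 0)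
  have hB0 : 0 ≤ B := (lipConst_nonneg _).trans (hBt 0)
  have hBH : 32 * B ≤ H := by
    have : B ≤ H / 32 := ciSup_le fun t =>
      (hsmooth _).lipConst_le_normC4.trans (by linarith [hHt t])
    linarith
  have hBA : B ^ 2 ≤ 32 * A * H := by
    have h1 : B ≤ √(32 * A * H) := ciSup_le fun t => Real.le_sqrt_of_sq_le
      ((hsmooth _).sq_lipConst_le.trans (by
        have := hHt t
        have := hAt t
        have := (hsmooth (θ^[t] ω)).normC4_nonneg
        gcongr))
    calc B ^ 2 ≤ √(32 * A * H) ^ 2 := pow_le_pow_left₀ hB0 h1 2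
      _ = 32 * A * H := Real.sq_sqrt (by positivity)
  obtain ⟨hε1, hε2⟩ := max_le_iff.1 hε
  have hε0 : 0 < ε := lt_of_lt_of_le (by positivity) hε1
  have hLε : α ^ 2 ≤ L * ε ^ 2 := by
    have h1 := pow_le_pow_left₀ (by positivity) hε1 2
    rw [mul_pow, ← Real.rpow_natCast ((L : ℝ) ^ (-(1 / 2) : ℝ)) 2, ← Real.rpow_mul hL0.le] at h1
    norm_num [Real.rpow_neg_one] at h1
    rw [← div_eq_mul_inv, div_le_iff₀ hL0] at h1
    linarith
  have hABε : 4 * α ^ 2 * A * B ≤ ε * (L * (1 - lam)) := by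
    have h1 : 4 * α ^ 2 * (L : ℝ)⁻¹ * (1 - lam)⁻¹ * A * B = 4 * α ^ 2 * A * B / (L * (1 - lam)) := by
      field_simp
    rw [h1, div_le_iff₀ (by positivity)] at hε2
    exact hε2
  have hρ0 : 0 ≤ (reductionConst * ε⁻¹ * H) *
      Real.exp (-(L * ε ^ 2 * α⁻¹ ^ 2 * (450 / H ^ 2))) := by
    have := reductionConst_pos
    positivity
  -- If B = 0, every coupling function along the orbit is constant and the fluctuation vanishes;
  -- this case is split off because τ is chosen of order d/B.
  rcases hB0.eq_or_lt with hB0 | hB0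
  · refine admitsReduction_of_forall_mem (E := ∅) (n := 0) (fun s hs => ?_) fun η hη =>
      Eventually.of_forall fun T => ?_
    · refine absurd ?_ hs
      rw [AdmitsReductionAt, fluctuation_eq_zero_of_lipConst_eq_zero hL (hsmooth _)
        (le_antisymm ((hBt _).trans hB0.ge) (lipConst_nonneg _)), abs_zero]
      exact hε0.le
    · simp only [Set.indicator_empty, Finset.sum_const_zero]
      positivity
  · set d := ε / α with hd
    have hd0 : 0 < d := by positivity
    have hdα : α * d = ε := by rw [hd]; field_simp
    -- The upper end keeps the budget: 0.25 + 0.05 + 0.56 · 1.2 = 0.972 < 1. The lower end gives the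
    -- exponent 1.1²/2 = 0.605.
    obtain ⟨τ, hτ1, hτ2⟩ := exists_rat_btwn
      (show 1.1 * (d / B) < 1.2 * (d / B) by
        have : 0 < d / B := by positivity
        linarith)
    have hτ0 : (0 : ℝ) < τ := lt_trans (by positivity) hτ1
    have hτB : B * τ ≤ 1.2 * d := by
      have h1 := mul_le_mul_of_nonneg_left hτ2.le hB0.le
      have h2 : B * (1.2 * (d / B)) = 1.2 * d := by field_simp
      linarith
    have hdAB : 4 * α * A * B ≤ d * (L * (1 - lam)) := by
      rw [← mul_le_mul_iff_right₀ hα]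
      calc α * (4 * α * A * B) = 4 * α ^ 2 * A * B := by ring
        _ ≤ ε * (L * (1 - lam)) := hABε
        _ = α * (d * (L * (1 - lam))) := by rw [← hdα]; ring
    obtain ⟨n, hn⟩ : ∃ n : ℕ, B * lam ^ (n + 1) < 0.05 * d := by
      have h1 : Tendsto (fun n : ℕ => B * lam ^ (n + 1)) atTop (nhds 0) := by
        have := (((tendsto_pow_atTop_nhds_zero_of_lt_one hlam.1.le hlam.2).comp
          (tendsto_add_atTop_nat 1)).const_mul B)
        simpa using this
      exact (h1.eventually_lt_const (by positivity)).exists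
    refine admitsReduction_of_forall_mem (E := deviationEvent P φ (n + 1) τ) (n := n + 1)
      (fun s hs => ?_) fun η hη => ?_
    · rw [AdmitsReductionAt, not_le, ← hdα] at hs
      exact mem_deviationEvent_of_lt_abs_fluctuation hθ hL hα hlam hrds hcontr hnodes hsmooth hm
        hAt hBt hB0 hτ0 hdAB (by linarith) x s hs
    · filter_upwards [hω n τ η hη] with T hT
      refine hT.trans (mul_le_mul_of_nonneg_right (add_le_add_left ?_ η) (Nat.cast_nonneg T))
      exact deviation_bound_le hL1 hα hε0 hlam hB0 hBH hBA hLε hABε hτ1.le measureReal_le_one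
        fun hτL => measureReal_deviationEvent_le hθ hL hrds hcontr hnodes (n + 1) hτ0.le hτL

theorem mainTheorem8 :
    ∃ C : ℝ, 0 < C ∧
      ∀ (Ω : Type*) [MeasurableSpace Ω] (P : Measure Ω) [IsProbabilityMeasure P]
        (θ : Ω → Ω) (_hθ : MeasurePreserving θ P P)
        (L : ℕ) (_hL : 1 ≤ L)
        (φ : Fin (L + 1) → ℕ → Ω → UnitAddCircle → UnitAddCircle)
        (h : Ω → UnitAddCircle → UnitAddCircle → ℝ)
        (α lam : ℝ) (_hα : 0 < α) (_hlam : lam ∈ Set.Ioo (0 : ℝ) 1)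
        (_hrds : ∀ i, IsRDS θ (φ i))
        (_hcontr : ∀ i ω x y, dist (φ i 1 ω x) (φ i 1 ω y) ≤ lam * dist x y)
        (_hnodes : IIDNodeMaps P θ φ)
        (_hcoupling : IIDCoupling P θ h),
        (∀ i, IsStationaryMeasure P (φ i) (codingMeasure P θ (φ 0)) ∧
          ∀ m, IsStationaryMeasure P (φ i) m → m = codingMeasure P θ (φ 0)) ∧
        ∀ᵐ ω ∂P, BddAbove (Set.range fun t : ℕ => normC4 (h (θ^[t] ω))) →
          ∀ ε : ℝ,
            max (α * (L : ℝ) ^ (-(1 / 2) : ℝ))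
              (4 * α ^ 2 * (L : ℝ)⁻¹ * (1 - lam)⁻¹ *
                (⨆ t : ℕ, normC0 (h (θ^[t] ω))) * (⨆ t : ℕ, lipConst (h (θ^[t] ω)))) ≤ ε →
            ∀ x : Fin (L + 1) → UnitAddCircle,
              AdmitsReduction θ φ h α (codingMeasure P θ (φ 0)) ε
                ((C * ε⁻¹ * ⨆ t : ℕ, normC4 (h (θ^[t] ω))) *
                  Real.exp (-(L * ε ^ 2 * α⁻¹ ^ 2 *
                    (450 / (⨆ t : ℕ, normC4 (h (θ^[t] ω))) ^ 2))))
                ω x := by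
  refine ⟨reductionConst, reductionConst_pos, ?_⟩
  intro Ω _ P _ θ hθ L hL φ h α lam hα hlam hrds hcontr hnodes hcoupling
  have hm := fun i => isStationaryMeasure_codingMeasure hθ hlam hrds hcontr hnodes i 0
  exact ⟨fun i => ⟨hm i, fun m hm' => hm'.unique hθ hlam hrds hcontr hnodes i (hm i)⟩,
    ae_admitsReduction hθ hL hα hlam hrds hcontr hnodes hcoupling.smooth hm⟩
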